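/- **Conventions.** Let $\lambda$ be a partition with conjugate $\lambda'$. $\mathrm{SSYT}(\lambda)$ is the set of fillings of the Young diagram of $\lambda$ (French notation, rows numbered from bottom to top) with positive integers that are weakly increasing from left to right along rows and strictly increasing from bottom to top along columns; $\mathrm{SSYT}(\lambda,n)$ consists of those with entries at most $n$. The reverse column reading word $\mathrm{revcrw}(T)$ lists the columns of $T$ from right to left, each read from bottom to top. For a word $w=w_1\cdots w_k$, $\mathrm{Icol}(w)=w_k\to(\cdots\to(w_1\to\emptyset))$ is its column insertion: $x\to T$ inserts $x$ into the first column, where $x$ replaces the smallest entry $\ge x$, which is then inserted into the next column, and so on; if a column has no such entry, $x$ is put on top of it. A multiline queue of shape $(\lambda,n)$ is a tuple $M=(B_1,\dots,B_L)$, $L=\lambda_1$, of subsets (rows, from bottom to top) of $\{1,\dots,n\}$ with $|B_j|=\lambda'_j$; the elements of $B_j$ are the balls of row $j$. Ferrari–Martin pairing: for $r=L,L-1,\dots,2$, label every unlabelled ball of row $r$ by $r$; then pair the balls of row $r$, from the largest label to the smallest and from left to right within a label, each with the first unlabelled ball weakly to its right in row $r-1$, wrapping around cyclically if necessary, which acquires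 the same label. The major index $\mathrm{maj}(M)$ is the sum of $\ell-r+1$ over all wrapping pairings, $\ell$ being the label and $r$ the row from which the pairing starts. $M$ is nonwrapping if $\mathrm{maj}(M)=0$; $\mathrm{MLQ}_0(\lambda,n)$ is the set of nonwrapping multiline queues of shape $(\lambda,n)$, and $\mathrm{MLQ}_0(\lambda)=\bigcup_n\mathrm{MLQ}_0(\lambda,n)$. The row word $\mathrm{rw}(M)$ lists the columns of the balls, rows from bottom to top and from left to right within a row. For an array $(B_1,\dots,B_L)$ of finite sets of positive integers, read rows $i+1$ and $i$ by columns from left to right (row $i+1$ before row $i$ in a column), writing "(" for a ball of row $i+1$ and ")" for a ball of row $i$, and match parentheses as usual. The operator $e_i^\star$ moves all balls of row $i+1$ with unmatched "(" to row $i$. With $e^\star_{[1,b]}=e_1^\star e_2^\star\cdots e_b^\star$ (operators act from right to left), put $\rho_N(B)=e^\star_{[1,L-1]}\cdots e^\star_{[1,2]}e^\star_{[1,1]}(B)$, where empty rows on top of the result are discarded. The insertion of a positive integer $k$ into $N=(N_1,\dots,N_L)$ is $k\to N=\rho_N(N_1,\dots,N_L,\{k\})$, and $\rho(w)$ is obtained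 by inserting $w_1,\dots,w_k$ successively into the empty multiline queue. The weights are $x^T=\prod_{c}x_{T(c)}$, over the boxes $c$ of $T$, and $x^M=\prod_j\prod_{b\in B_j}x_b$. **Theorem.** Let $\lambda$ be a partition. The maps $$\mathrm{mlq}=\rho\circ\mathrm{revcrw}:\mathrm{SSYT}(\lambda)\to\mathrm{MLQ}_0(\lambda),\qquad \mathrm{tab}=\mathrm{Icol}\circ\mathrm{rw}:\mathrm{MLQ}_0(\lambda)\to\mathrm{SSYT}(\lambda)$$ are well defined, mutually inverse bijections. They preserve weights: $x^{\mathrm{mlq}(T)}=x^T$ for $T\in\mathrm{SSYT}(\lambda)$ and $x^{\mathrm{tab}(M)}=x^M$ for $M\in\mathrm{MLQ}_0(\lambda)$. For every $n$ they restrict to bijections between $\mathrm{SSYT}(\lambda,n)$ and $\mathrm{MLQ}_0(\lambda,n)$. Moreover, they are compatible with insertion: for every $k>0$, $T\in\mathrm{SSYT}(\lambda)$ and $M\in\mathrm{MLQ}_0(\lambda)$, $$\mathrm{mlq}(k\to T)=k\to\mathrm{mlq}(T),\qquad \mathrm{tab}(k\to M)=k\to\mathrm{tab}(M),$$ where $\mathrm{mlq}$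 and $\mathrm{tab}$ on the left are given by the same formulas. -/

import Mathlib

namespace MultilineQueue

/-! ### Semistandard tableaux

A partition is a `YoungDiagram`: its parts are `lam.rowLen 0, lam.rowLen 1, …` and the parts of its
conjugate are `lam.colLen 0, lam.colLen 1, …`. Row `0` is the bottom row (French notation).
A tableau is recorded as the list of its columns from left to right, and each column as the list of
its entries from bottom to top. -/

/-- The columns, from left to right, of a tableau; each is listed from bottom to top. -/
def columns {lam : YoungDiagram} (T : SemistandardYoungTableau lam) : List (List ℕ) :=
  (List.range (lam.rowLen 0)).map fun j => (List.range (lam.colLen j)).map fun i => T i j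

/-- `SSYT(λ)`: semistandard Young tableaux of shape `λ` with positive integer entries. -/
def SSYT (lam : YoungDiagram) : Set (List (List ℕ)) :=
  {C | ∃ T : SemistandardYoungTableau lam, (∀ i j, (i, j) ∈ lam → 0 < T i j) ∧ C = columns T}

/-- `SSYT(λ, n)`: those whose entries are at most `n`. -/
def SSYTBounded (lam : YoungDiagram) (n : ℕ) : Set (List (List ℕ)) :=
  {C | ∃ T : SemistandardYoungTableau lam,
    (∀ i j, (i, j) ∈ lam → 0 < T i j ∧ T i j ≤ n) ∧ C = columns T}

/-- Column reading word: columns from left to right, each one read from top to bottom. -/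
def crw (T : List (List ℕ)) : List ℕ := T.flatMap List.reverse

/-- Reverse column reading word. -/
def revcrw (T : List (List ℕ)) : List ℕ := (crw T).reverse

/-- The content monomial `x^T`. -/
noncomputable def tabWeight (T : List (List ℕ)) : MvPolynomial ℕ ℤ :=
  (T.flatten.map MvPolynomial.X).prod

/-- Inserts `x` into one (strictly increasing) column: `x` replaces the smallest entry `≥ x`, which
is the second component of the result; if there is none, `x` is put on top of the column. -/
def bumpColumn (x : ℕ) : List ℕ → List ℕ × Option ℕ
  | [] => ([x], none)
  | y :: ys =>
    if x ≤ y then (x :: ys, some y)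
    else (y :: (bumpColumn x ys).1, (bumpColumn x ys).2)

/-- Column insertion `x → T`: bumped entries are inserted into the next column to the right. -/
def insertTab (x : ℕ) : List (List ℕ) → List (List ℕ)
  | [] => [[x]]
  | C :: Cs =>
    match bumpColumn x C with
    | (C', none) => C' :: Cs
    | (C', some y) => C' :: insertTab y Cs

/-- `Icol(w) = w_k → (⋯ → (w_2 → (w_1 → ∅)) ⋯ )`. -/
def Icol (w : List ℕ) : List (List ℕ) := w.foldl (fun T x => insertTab x T) []

/-! ### Multiline queues

An array of balls is the list `(B_1, …, B_L)` of its rows from bottom to top; a row is the finite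
set of the columns of its balls. Row `r` is the list entry with index `r - 1`. -/

/-- A pairing of the Ferrari–Martin algorithm: the row it starts from, its label, the column in the
row below at which it ends, and whether it wraps. -/
structure Pairing where
  row : ℕ
  label : ℕ
  target : ℕ
  wraps : Bool

/-- The first element of `U` weakly to the right of column `c`, cyclically: if there is none,
one wraps around to the leftmost element of `U`. -/
def firstWeaklyRight (U : Finset ℕ) (c : ℕ) : ℕ :=
  if h : (U.filter (c ≤ ·)).Nonempty then (U.filter (c ≤ ·)).min' h
  else if h' : U.Nonempty then U.min' h' else c

/-- Pairs the given labelled balls `(label, column)` of row `r`, in the listed order, each with the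
first still unlabelled ball weakly to its right in the row below. `U` is the set of the unlabelled
balls in the row below. -/
def pairBalls (r : ℕ) : List (ℕ × ℕ) → Finset ℕ → List Pairing
  | [], _ => []
  | b :: bs, U =>
    { row := r, label := b.1, target := firstWeaklyRight U b.2,
      wraps := decide (∀ u ∈ U, u < b.2) } ::
      pairBalls r bs (U.erase (firstWeaklyRight U b.2))

/-- Pairing order: from the largest label to the smallest, left to right within a label. -/
def priorityOrder (row : List (ℕ × ℕ)) : List (ℕ × ℕ) :=
  row.mergeSort fun a b => decide (b.1 < a.1 ∨ (a.1 = b.1 ∧ a.2 ≤ b.2))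

/-- The Ferrari–Martin algorithm on the rows `r, r + 1, …` of a multiline queue. It returns the
labelled balls `(label, column)` of row `r`, and all pairings that start in rows above row `r`. -/
def fm (r : ℕ) : List (Finset ℕ) → List (ℕ × ℕ) × List Pairing
  | [] => ([], [])
  | B :: Bs =>
    let ps := pairBalls (r + 1) (priorityOrder (fm (r + 1) Bs).1) B
    (ps.map (fun p => (p.label, p.target)) ++
        ((B \ (ps.map Pairing.target).toFinset).sort (· ≤ ·)).map (fun c => (r, c)),
      ps ++ (fm (r + 1) Bs).2)

/-- The major index `∑_p δ(p) (ℓ(p) - r(p) + 1)`. -/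
def maj (M : List (Finset ℕ)) : ℕ :=
  ((fm 1 M).2.map fun p => if p.wraps then p.label - p.row + 1 else 0).sum

/-- `MLQ(λ, n)`: there are `λ_1` rows, all of them subsets of `{1, …, n}`, and row `j` has
`λ'_j` balls. -/
def MLQ (lam : YoungDiagram) (n : ℕ) : Set (List (Finset ℕ)) :=
  {M | M.length = lam.rowLen 0 ∧ ∀ j < lam.rowLen 0,
    M.getD j ∅ ⊆ Finset.Icc 1 n ∧ (M.getD j ∅).card = lam.colLen j}

/-- `MLQ_0(λ, n)`: nonwrapping multiline queues of shape `λ` on `n` columns. -/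
def MLQ₀Bounded (lam : YoungDiagram) (n : ℕ) : Set (List (Finset ℕ)) :=
  {M | M ∈ MLQ lam n ∧ maj M = 0}

/-- `MLQ_0(λ)`: nonwrapping multiline queues of shape `λ`, with any number of columns. -/
def MLQ₀ (lam : YoungDiagram) : Set (List (Finset ℕ)) := ⋃ n, MLQ₀Bounded lam n

/-- Row word: the columns of the balls, rows from bottom to top, each from left to right. -/
def rw (M : List (Finset ℕ)) : List ℕ := M.flatMap fun B => B.sort (· ≤ ·)

/-- The spectral weight `x^M`. -/
noncomputable def mlqWeight (M : List (Finset ℕ)) : MvPolynomial ℕ ℤ :=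
  (M.map fun B => ∏ b ∈ B, MvPolynomial.X b).prod

/-! ### Collapsing -/

/-- The parentheses of `Par(A, B)`, for a row `A` and the row `B` below it. The columns are scanned
from left to right, and from top to bottom within a column; a ball of `A` gives an opening
parenthesis (`true`), a ball of `B` a closing one (`false`). Each comes with its column. -/
def par (A B : Finset ℕ) : List (Bool × ℕ) :=
  ((A ∪ B).sort (· ≤ ·)).flatMap fun c =>
    (if c ∈ A then [(true, c)] else []) ++ (if c ∈ B then [(false, c)] else [])

/-- Bracketing rule: the unmatched opening parentheses of a parenthesis word. The second argument
is the stack of the opening parentheses read so far and not yet matched, the last one first. -/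
def unmatchedOpen : List (Bool × ℕ) → List ℕ → List ℕ
  | [], st => st
  | (true, c) :: w, st => unmatchedOpen w (c :: st)
  | (false, _) :: w, st => unmatchedOpen w st.tail

/-- The balls of `A` that are unmatched above in `Par(A, B)`. -/
def unmatchedAbove (A B : Finset ℕ) : Finset ℕ := (unmatchedOpen (par A B) []).toFinset

/-- The operator `e_i^⋆` (`i ≥ 1`): all balls of row `i + 1` that are unmatched above in
`Par(B_{i+1}, B_i)` drop to row `i`. -/
def eStar (i : ℕ) (M : List (Finset ℕ)) : List (Finset ℕ) :=
  let A := M.getD i ∅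
  let B := M.getD (i - 1) ∅
  (M.set i (A \ unmatchedAbove A B)).set (i - 1) (B ∪ unmatchedAbove A B)

/-- `e^⋆_{[1,b]} = e_1^⋆ e_2^⋆ ⋯ e_b^⋆`, applied from right to left. -/
def eStarRange : ℕ → List (Finset ℕ) → List (Finset ℕ)
  | 0, M => M
  | b + 1, M => eStarRange b (eStar (b + 1) M)

/-- `e^⋆_{[1,k]} ⋯ e^⋆_{[1,2]} e^⋆_{[1,1]}`, applied from right to left. -/
def collapseSteps : ℕ → List (Finset ℕ) → List (Finset ℕ)
  | 0, M => M
  | k + 1, M => eStarRange (k + 1) (collapseSteps k M)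

/-- Collapsing `ρ_N(B) = e^⋆_{[1,L-1]} ⋯ e^⋆_{[1,1]}(B)`. The result is regarded as a multiline queue,
of some shape `μ` with `μ_1` rows, so the empty rows on its top are discarded. -/
def rhoN (M : List (Finset ℕ)) : List (Finset ℕ) :=
  (collapseSteps (M.length - 1) M).rdropWhile (fun B => decide (B = ∅))

/-- Insertion `k → N = ρ_N(N_1, …, N_L, {k})`. -/
def insertMLQ (k : ℕ) (N : List (Finset ℕ)) : List (Finset ℕ) := rhoN (N ++ [{k}])

/-- `ρ(w)`: the letters of `w` are inserted one after the other into the empty multiline queue. -/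
def rho (w : List ℕ) : List (Finset ℕ) := w.foldl (fun N k => insertMLQ k N) []

/-- `mlq = ρ ∘ revcrw`. -/
def mlq (T : List (List ℕ)) : List (Finset ℕ) := rho (revcrw T)

/-- `tab = Icol ∘ rw`. -/
def tab (M : List (Finset ℕ)) : List (List ℕ) := Icol (rw M)

end MultilineQueue

open MultilineQueue

namespace MultilineQueue

/-! ### Column insertion of letters and words -/

/-! Pairing without wrapping succeeds exactly when each row can be matched injectively, weakly to
the right, into the row below. By a Hall-type count this means that, for every `t`, the lower row
has at least as many balls in the columns `≥ t`. Greedy pairing meets this condition in whatever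
order the balls are treated, so the labels play no role and `maj M = 0` becomes `RowChain M`
(`maj_eq_zero_iff`).

The bridge to tableaux is the row word. When a letter is inserted into such a queue, at most one
ball drops at each level. A drop replaces the product of two increasing words by one that acts in
the same way under column insertion (`plactic_drop`, `HasExcess.plactic`). Hence the row word of `k
→ M` is equivalent to the row word of `M` followed by `k` (`insertMLQ_spec`), and `tab (rho w) =
Icol w` for every word `w` (`rho_spec`). Since `Icol` recovers a tableau from its reverse column
reading word (`IsTableau.Icol_revcrw`), `tab ∘ mlq` is the identity.

For the other composite it is enough that `tab` is injective. The column lengths of `tab M` are the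
row sizes of `M` (`Nonwrapping.map_length_tab`): inserting a dominated chain of words into its first
word leaves that column at its length and bumps out another dominated chain with the same lengths.
The last letter of the row word is the largest ball of the top row. Removing it leaves a queue whose
tableau has known shape, and column insertion can be undone once the shape before insertion is known
(`insertTab_injective`). Induction on the number of balls gives `tab_injective`. Compatibility of
`mlq` with insertion follows by applying `tab` to both sides, and weights are preserved because
column insertion only permutes letters. -/

theorem bumpColumn_perm (x : ℕ) (C : List ℕ) :
    ((bumpColumn x C).1 ++ (bumpColumn x C).2.toList).Perm (x :: C) := by
  induction C with
  | nil => simp [bumpColumn]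
  | cons c C ih =>
    rw [bumpColumn]
    split_ifs with h
    · simp only [Option.toList_some, List.cons_append]
      exact (List.perm_append_comm.trans (by simp)).cons x
    · simp only [List.cons_append]
      exact (ih.cons c).trans (List.Perm.swap x c C)

theorem mem_bumpColumn {x a : ℕ} {C : List ℕ} (h : a ∈ (bumpColumn x C).1) : a = x ∨ a ∈ C := by
  have := (bumpColumn_perm x C).subset (List.mem_append_left _ h)
  simpa using this

theorem self_mem_bumpColumn (x : ℕ) (C : List ℕ) : x ∈ (bumpColumn x C).1 := by
  induction C with
  | nil => simp [bumpColumn]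
  | cons c C ih =>
    rw [bumpColumn]
    split_ifs <;> simp [ih]

theorem bumpColumn_of_forall_lt {x : ℕ} {C : List ℕ} (h : ∀ c ∈ C, c < x) :
    bumpColumn x C = (C ++ [x], none) := by
  induction C with
  | nil => rfl
  | cons c C ih =>
    have hc : ¬ x ≤ c := by simpa using h c (by simp)
    rw [bumpColumn, if_neg hc, ih fun a ha => h a (by simp [ha])]
    rfl

theorem lt_of_bumpColumn_none {x : ℕ} {C : List ℕ} (h : (bumpColumn x C).2 = none) :
    ∀ c ∈ C, c < x := by
  induction C with
  | nil => simp
  | cons c C ih =>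
    rw [bumpColumn] at h
    split_ifs at h with hc
    simp only [List.mem_cons, forall_eq_or_imp]
    exact ⟨by omega, ih h⟩

theorem bumpColumn_some {x y : ℕ} {C : List ℕ} (hC : C.Pairwise (· < ·))
    (h : (bumpColumn x C).2 = some y) : x ≤ y ∧ y ∈ C ∧ ∀ c ∈ C, x ≤ c → y ≤ c := by
  induction C with
  | nil => simp [bumpColumn] at h
  | cons c C ih =>
    rw [List.pairwise_cons] at hC
    rw [bumpColumn] at h
    split_ifs at h with hc
    · obtain rfl : c = y := by simpa using h
      refine ⟨hc, by simp, fun a ha _ => ?_⟩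
      rcases List.mem_cons.1 ha with rfl | ha
      · rfl
      · exact (hC.1 a ha).le
    · obtain ⟨h1, h2, h3⟩ := ih hC.2 h
      refine ⟨h1, by simp [h2], fun a ha hxa => ?_⟩
      rcases List.mem_cons.1 ha with rfl | ha
      · omega
      · exact h3 a ha hxa

theorem bumpColumn_sorted {x : ℕ} {C : List ℕ} (hC : C.Pairwise (· < ·)) :
    (bumpColumn x C).1.Pairwise (· < ·) := by
  induction C with
  | nil => simp [bumpColumn]
  | cons c C ih =>
    rw [List.pairwise_cons] at hC
    rw [bumpColumn]
    split_ifs with h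
    · exact List.pairwise_cons.2 ⟨fun a ha => h.trans_lt (hC.1 a ha), hC.2⟩
    · refine List.pairwise_cons.2 ⟨fun a ha => ?_, ih hC.2⟩
      rcases mem_bumpColumn ha with rfl | ha
      · omega
      · exact hC.1 a ha

/-- Inserts the letters of a word into one column; the second component is the word of the bumped
entries. -/
def bumpWord : List ℕ → List ℕ → List ℕ × List ℕ
  | C, [] => (C, [])
  | C, x :: w =>
    ((bumpWord (bumpColumn x C).1 w).1,
      (bumpColumn x C).2.toList ++ (bumpWord (bumpColumn x C).1 w).2)

/-- Inserts the letters of a word into a tableau. -/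
def insertWord (T : List (List ℕ)) (w : List ℕ) : List (List ℕ) :=
  w.foldl (fun T x => insertTab x T) T

theorem insertWord_append (T : List (List ℕ)) (v w : List ℕ) :
    insertWord T (v ++ w) = insertWord (insertWord T v) w := List.foldl_append

theorem Icol_append (v w : List ℕ) : Icol (v ++ w) = insertWord (Icol v) w := List.foldl_append

/-- Column insertion is a cascade: later columns see only the bumped letters, in the order of
bumping. Statements about tableaux thus reduce to one column and induction. -/
theorem insertWord_cons (C : List ℕ) (T : List (List ℕ)) (w : List ℕ) :
    insertWord (C :: T) w = (bumpWord C w).1 :: insertWord T (bumpWord C w).2 := by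
  induction w generalizing C T with
  | nil => rfl
  | cons x w ih =>
    have : insertWord (C :: T) (x :: w) = insertWord (insertTab x (C :: T)) w := rfl
    rw [this, insertTab, bumpWord]
    rcases bumpColumn x C with ⟨C', _ | y⟩
    · simp [ih]
    · simp only [ih]
      rfl

theorem bumpWord_sorted {C : List ℕ} (hC : C.Pairwise (· < ·)) (w : List ℕ) :
    (bumpWord C w).1.Pairwise (· < ·) := by
  induction w generalizing C with
  | nil => exact hC
  | cons x w ih => exact ih (bumpColumn_sorted hC)

theorem bumpWord_cons_of_forall_lt {c : ℕ} {w : List ℕ} (hw : ∀ x ∈ w, c < x) (C : List ℕ) :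
    bumpWord (c :: C) w = (c :: (bumpWord C w).1, (bumpWord C w).2) := by
  induction w generalizing C with
  | nil => rfl
  | cons x w ih =>
    have hc : ¬ x ≤ c := by simpa using hw x (by simp)
    rw [bumpWord, bumpColumn, if_neg hc, ih fun a ha => hw a (by simp [ha])]
    rfl

theorem bumpWord_of_sorted {C w : List ℕ} (h : (C ++ w).Pairwise (· < ·)) :
    bumpWord C w = (C ++ w, []) := by
  induction w generalizing C with
  | nil => simp [bumpWord]
  | cons x w ih =>
    have h' : ∀ c ∈ C, c < x := fun c hc => (List.pairwise_append.1 h).2.2 c hc x (by simp)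
    rw [bumpWord, bumpColumn_of_forall_lt h', ih (by simpa using h)]
    simp

/-- The elementary plactic relations, in the form suited to column insertion. -/
inductive KnuthStep : List ℕ → List ℕ → Prop
  | left {x y z : ℕ} : x < y → y ≤ z → KnuthStep [x, z, y] [z, x, y]
  | right {x y z : ℕ} : x ≤ y → y < z → KnuthStep [y, z, x] [y, x, z]

/-- This is the inductive engine for plactic invariance: a column absorbs the relation or passes it
on to the next column. A bottom entry `c` below all three letters is inert; otherwise the smallest
letter `x` satisfies `x ≤ c`, and the cases depend on which other letters are also `≤ c`. A relation
of type `left` may come out as one of type `right`. -/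
theorem KnuthStep.bumpWord {C w w' : List ℕ} (hC : C.Pairwise (· < ·)) (h : KnuthStep w w') :
    (bumpWord C w).1 = (bumpWord C w').1 ∧
      ((bumpWord C w).2 = (bumpWord C w').2 ∨
        KnuthStep (bumpWord C w).2 (bumpWord C w').2) := by
  induction C with
  | nil =>
    cases h with
    | @left x y z h1 h2 =>
      have h3 : ¬ z ≤ x := by omega
      have h4 : ¬ y ≤ x := by omega
      have h5 : x ≤ z := by omega
      simp [MultilineQueue.bumpWord, bumpColumn, *]
    | @right x y z h1 h2 =>
      have h3 : ¬ z ≤ x := by omega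
      have h4 : ¬ z ≤ y := by omega
      simp [MultilineQueue.bumpWord, bumpColumn, *]
  | cons c C ih =>
    rw [List.pairwise_cons] at hC
    by_cases hw : ∀ a ∈ w, c < a
    · have hw' : ∀ a ∈ w', c < a := by
        cases h <;> simp at hw ⊢ <;> tauto
      rw [bumpWord_cons_of_forall_lt hw, bumpWord_cons_of_forall_lt hw']
      simpa using ih hC.2
    · cases h with
      | @left x y z h1 h2 =>
        have hx : x ≤ c := by
          by_contra hx
          exact hw (by simp; omega)
        have h3 : ¬ z ≤ x := by omega
        have h4 : ¬ y ≤ x := by omega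
        have h5 : x ≤ z := by omega
        by_cases hz : z ≤ c
        · simp only [MultilineQueue.bumpWord, bumpColumn, hx, h3, h4, h5, hz, if_true, if_false]
          cases C with
          | nil => simp [bumpColumn, h2]
          | cons d C =>
            have hd : c < d := hC.1 d (by simp)
            have h6 : z ≤ d := by omega
            have h7 : y ≤ d := by omega
            simp only [bumpColumn, h2, h6, h7, if_true, true_and]
            exact Or.inr (.right hz hd)
        · simp only [MultilineQueue.bumpWord, bumpColumn, hx, h3, h4, hz, if_true, if_false,
            true_and]
          have hs := bumpColumn_sorted (x := z) hC.2
          rcases hy : (bumpColumn y (bumpColumn z C).1).2 with _ | y'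
          · have := lt_of_bumpColumn_none hy z (self_mem_bumpColumn z C)
            omega
          rcases hz' : (bumpColumn z C).2 with _ | z'
          · simp
          · obtain ⟨-, hy1, hy2⟩ := bumpColumn_some hs hy
            obtain ⟨hz1, -, -⟩ := bumpColumn_some hC.2 hz'
            have hcy : c < y' := by
              rcases mem_bumpColumn hy1 with h | h
              · omega
              · exact hC.1 _ h
            simp only [Option.toList_some, List.append_nil, List.cons_append, List.nil_append]
            exact Or.inr (.left hcy ((hy2 z (self_mem_bumpColumn z C) h2).trans hz1))
      | @right x y z h1 h2 =>
        have hx : x ≤ c := by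
          by_contra hx
          exact hw (by simp; omega)
        have h3 : ¬ z ≤ x := by omega
        have h4 : ¬ z ≤ y := by omega
        by_cases hy : y ≤ c
        · simp only [MultilineQueue.bumpWord, bumpColumn, h1, hy, h3, h4, if_true, if_false,
            true_and]
          rcases hz' : (bumpColumn z C).2 with _ | z'
          · simp
          · obtain ⟨-, hz1, -⟩ := bumpColumn_some hC.2 hz'
            exact Or.inr (.right hy (hC.1 _ hz1))
        · have hz : ¬ z ≤ c := by omega
          simp only [MultilineQueue.bumpWord, bumpColumn, hx, hy, hz, h3, if_true, if_false,
            true_and]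
          have hs := bumpColumn_sorted (x := y) hC.2
          rcases hz' : (bumpColumn z (bumpColumn y C).1).2 with _ | z'
          · simp
          rcases hy' : (bumpColumn y C).2 with _ | y'
          · have h5 := bumpColumn_of_forall_lt (lt_of_bumpColumn_none hy')
            rw [h5] at hz'
            have h6 : ∀ a ∈ C ++ [y], a < z := by
              intro a ha
              rcases List.mem_append.1 ha with ha | ha
              · exact (lt_of_bumpColumn_none hy' a ha).trans h2
              · simp at ha; omega
            rw [bumpColumn_of_forall_lt h6] at hz'
            simp at hz'
          · obtain ⟨hy1, hy2, hy3⟩ := bumpColumn_some hC.2 hy'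
            obtain ⟨hz1, hz2, -⟩ := bumpColumn_some hs hz'
            have hcy : c < y' := hC.1 _ hy2
            -- Minimality of `y'` gives `y' ≤ z'`. Equality is impossible because the only copy of
            -- `y'` has already left the column.
            have hyz : y' < z' := by
              have hzC : z' ∈ C := (mem_bumpColumn hz2).resolve_left (by omega)
              refine lt_of_le_of_ne (hy3 z' hzC (by omega)) ?_
              rintro rfl
              have hp := (bumpColumn_perm y C).count_eq y'
              rw [hy'] at hp
              have h5 := List.count_pos_iff.2 hz2
              have h6 : List.count y' C ≤ 1 := List.nodup_iff_count_le_one.1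
                (hC.2.imp fun h => h.ne) y'
              have h7 : y ≠ y' := by omega
              simp [List.count_append, h7] at hp
              omega
            simp only [Option.toList_some, List.append_nil, List.cons_append, List.nil_append]
            exact Or.inr (.right hcy.le hyz)

/-- Two words are plactically equivalent if they can be exchanged in column insertions. -/
def Plactic (w w' : List ℕ) : Prop :=
  ∀ T : List (List ℕ), (∀ C ∈ T, C.Pairwise (· < ·)) → insertWord T w = insertWord T w'

theorem insertTab_sorted {T : List (List ℕ)} (hT : ∀ C ∈ T, C.Pairwise (· < ·)) (x : ℕ) :
    ∀ C ∈ insertTab x T, C.Pairwise (· < ·) := by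
  induction T generalizing x with
  | nil => simp [insertTab]
  | cons C T ih =>
    have hC := bumpColumn_sorted (x := x) (hT C (by simp))
    have hT' := fun D hD => hT D (List.mem_cons_of_mem _ hD)
    rw [insertTab]
    rcases h : bumpColumn x C with ⟨C', _ | y⟩ <;> rw [h] at hC <;>
      simp only [List.mem_cons, forall_eq_or_imp]
    exacts [⟨hC, hT'⟩, ⟨hC, ih hT' y⟩]

theorem insertWord_sorted {T : List (List ℕ)} (hT : ∀ C ∈ T, C.Pairwise (· < ·)) (w : List ℕ) :
    ∀ C ∈ insertWord T w, C.Pairwise (· < ·) := by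
  induction w generalizing T with
  | nil => exact hT
  | cons x w ih => exact ih (insertTab_sorted hT x)

theorem KnuthStep.plactic {w w' : List ℕ} (h : KnuthStep w w') : Plactic w w' := by
  intro T hT
  induction T generalizing w w' with
  | nil =>
    cases h with
    | @left x y z h1 h2 =>
      have h3 : ¬ z ≤ x := by omega
      have h4 : ¬ y ≤ x := by omega
      have h5 : x ≤ z := by omega
      simp [insertWord, insertTab, bumpColumn, *]
    | @right x y z h1 h2 =>
      have h3 : ¬ z ≤ x := by omega
      have h4 : ¬ z ≤ y := by omega
      simp [insertWord, insertTab, bumpColumn, *]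
  | cons C T ih =>
    rw [insertWord_cons, insertWord_cons]
    obtain ⟨h1, h2⟩ := h.bumpWord (hT C (by simp))
    rw [h1]
    rcases h2 with h2 | h2
    · rw [h2]
    · rw [ih h2 fun D hD => hT D (by simp [hD])]

theorem Plactic.refl (w : List ℕ) : Plactic w w := fun _ _ => rfl

theorem Plactic.symm {v w : List ℕ} (h : Plactic v w) : Plactic w v := fun T hT => (h T hT).symm

theorem Plactic.trans {u v w : List ℕ} (h : Plactic u v) (h' : Plactic v w) : Plactic u w :=
  fun T hT => (h T hT).trans (h' T hT)

theorem Plactic.append_left {v w : List ℕ} (h : Plactic v w) (u : List ℕ) :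
    Plactic (u ++ v) (u ++ w) := fun T hT => by
  rw [insertWord_append, insertWord_append, h _ (insertWord_sorted hT u)]

theorem Plactic.append_right {v w : List ℕ} (h : Plactic v w) (u : List ℕ) :
    Plactic (v ++ u) (w ++ u) := fun T hT => by
  rw [insertWord_append, insertWord_append, h _ hT]

theorem Plactic.Icol_eq {v w : List ℕ} (h : Plactic v w) : Icol v = Icol w := h [] (by simp)

/-! ### Exchanging column words -/

/-- `P` has at least as many entries `≥ t` as `Q`, for every `t`: the entries of `Q` can be matched
injectively with larger or equal entries of `P`. -/
def Dominated (Q P : List ℕ) : Prop :=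
  ∀ t, Q.countP (fun a => decide (t ≤ a)) ≤ P.countP (fun a => decide (t ≤ a))

/-- `P` has at least as many entries `≤ t` as `Q`, for every `t`: increasing columns `P` and `Q` can
stand side by side in a semistandard tableau. -/
def RowLE (P Q : List ℕ) : Prop :=
  ∀ t, Q.countP (fun a => decide (a ≤ t)) ≤ P.countP (fun a => decide (a ≤ t))

theorem Dominated.trans {P Q R : List ℕ} (h : Dominated P Q) (h' : Dominated Q R) :
    Dominated P R := fun t => (h t).trans (h' t)

theorem Dominated.length_le {P Q : List ℕ} (h : Dominated Q P) : Q.length ≤ P.length := by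
  have := h 0
  simpa using this

theorem Dominated.append_right {P Q : List ℕ} (h : Dominated Q P) (R : List ℕ) :
    Dominated Q (P ++ R) := fun t => by
  rw [List.countP_append]
  exact (h t).trans (Nat.le_add_right _ _)

theorem RowLE.length_le {P Q : List ℕ} (h : RowLE P Q) : Q.length ≤ P.length := by
  -- The sum serves only as a common upper bound for all entries.
  have := h (P.sum + Q.sum)
  rw [List.countP_eq_length.2, List.countP_eq_length.2] at this
  · exact this
  · intro a ha
    have := List.single_le_sum (l := P) (by simp) a ha
    simp; omega
  · intro a ha
    have := List.single_le_sum (l := Q) (by simp) a ha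
    simp; omega

theorem rowLE_nil (P : List ℕ) : RowLE P [] := fun t => by simp

theorem rowLE_cons_iff {p q : ℕ} {P Q : List ℕ} (hP : (p :: P).Pairwise (· < ·))
    (hQ : (q :: Q).Pairwise (· < ·)) : RowLE (p :: P) (q :: Q) ↔ p ≤ q ∧ RowLE P Q := by
  rw [List.pairwise_cons] at hP hQ
  constructor
  · intro h
    have hpq : p ≤ q := by
      by_contra hlt
      have h1 := h q
      have h2 : (p :: P).countP (fun a => decide (a ≤ q)) = 0 := by
        rw [List.countP_eq_zero]
        intro a ha
        rcases List.mem_cons.1 ha with rfl | ha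
        · simpa using hlt
        · have := hP.1 a ha
          simp; omega
      rw [h2] at h1
      simp at h1
    refine ⟨hpq, fun t => ?_⟩
    by_cases ht : q ≤ t
    · have h1 := h t
      have hpt : p ≤ t := by omega
      simpa [List.countP_cons, ht, hpt] using h1
    · rw [List.countP_eq_zero.2]
      · omega
      · intro a ha
        have := hQ.1 a ha
        simp; omega
  · rintro ⟨h1, h2⟩ t
    have h3 := h2 t
    simp only [List.countP_cons, decide_eq_true_eq]
    split_ifs <;> omega

theorem RowLE.exists_cons {q : ℕ} {P Q : List ℕ} (h : RowLE P (q :: Q)) : ∃ p P', P = p :: P' := by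
  cases P with
  | nil => simpa using h.length_le
  | cons p P => exact ⟨p, P, rfl⟩

theorem RowLE.of_cons {q : ℕ} {P Q : List ℕ} (h : RowLE P (q :: Q)) : RowLE P Q :=
  fun t => ((List.sublist_cons_self q Q).countP_le).trans (h t)

/-- Let `q` and `p` be the largest entries of the two words; dominance forces `q ≤ p < u` and
survives their removal. By induction `p` can be moved next to `q` and `u`, where a single relation
`p q u ~ p u q` lets `u` pass `q`. Then `p` is moved back, and a second use of the induction
hypothesis takes `u` past the rest of `Q`. -/
theorem plactic_move_large {P Q : List ℕ} {u : ℕ} (hP : P.Pairwise (· < ·))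
    (hQ : Q.Pairwise (· < ·)) (h : Dominated Q P) (hu : ∀ p ∈ P, p < u) :
    Plactic (P ++ Q ++ [u]) (P ++ [u] ++ Q) := by
  induction Q using List.reverseRecOn generalizing P u with
  | nil => simpa using Plactic.refl _
  | append_singleton Q q ih =>
    rcases List.eq_nil_or_concat' P with rfl | ⟨P, p, rfl⟩
    · simpa using h.length_le
    rw [List.pairwise_append] at hQ hP
    simp only [List.mem_singleton, forall_eq] at hQ hP
    have hqp : q ≤ p := by
      by_contra hlt
      have h1 := h q
      have h2 : (P ++ [p]).countP (fun a => decide (q ≤ a)) = 0 := by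
        rw [List.countP_eq_zero]
        intro a ha
        rcases List.mem_append.1 ha with ha | ha
        · have := hP.2.2 a ha
          simp; omega
        · simp at ha
          simp; omega
      rw [h2] at h1
      simp at h1
    have h' : Dominated Q P := fun t => by
      by_cases ht : t ≤ q
      · have htp : t ≤ p := by omega
        have := h t
        simpa [List.countP_append, ht, htp] using this
      · rw [List.countP_eq_zero.2]
        · omega
        · intro a ha
          have := hQ.2.2 a ha
          simp; omega
    have hpu : p < u := hu p (by simp)
    have e1 := ih (u := p) hP.1 hQ.1 h' hP.2.2
    have e2 := ih (u := u) (P := P ++ [p]) (List.pairwise_append.2 (by simpa using hP)) hQ.1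
      (h'.append_right _) hu
    have e3 := (KnuthStep.right hqp hpu).plactic
    have s1 : Plactic (P ++ [p] ++ (Q ++ [q]) ++ [u]) (P ++ Q ++ [p, q, u]) := by
      simpa using e1.symm.append_right [q, u]
    have s2 : Plactic (P ++ Q ++ [p, q, u]) (P ++ Q ++ [p, u, q]) := e3.symm.append_left _
    have s3 : Plactic (P ++ Q ++ [p, u, q]) (P ++ [p] ++ Q ++ [u, q]) := by
      simpa using e1.append_right [u, q]
    have s4 : Plactic (P ++ [p] ++ Q ++ [u, q]) (P ++ [p] ++ [u] ++ (Q ++ [q])) := by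
      simpa using e2.append_right [q]
    exact s1.trans (s2.trans (s3.trans s4))

/-- Mirror image of `plactic_move_large`, peeling off the smallest entries `q ≤ p` and using `p u q
~ u p q`. -/
theorem plactic_move_small {P Q : List ℕ} {u : ℕ} (hP : P.Pairwise (· < ·))
    (hQ : Q.Pairwise (· < ·)) (h : RowLE Q P) (hu : ∀ q ∈ Q, u < q) :
    Plactic (P ++ u :: Q) (u :: (P ++ Q)) := by
  induction P generalizing Q u with
  | nil => exact Plactic.refl _
  | cons p P ih =>
    obtain ⟨q, Q, rfl⟩ := h.exists_cons
    obtain ⟨hqp, h'⟩ := (rowLE_cons_iff hQ hP).1 h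
    have h'' := h.of_cons
    have hQ' := hQ
    rw [List.pairwise_cons] at hP hQ
    have e1 := ih hP.2 hQ.2 h' hQ.1
    have e2 := ih hP.2 hQ' h'' hu
    have e3 := (KnuthStep.left (hu q (by simp)) hqp).plactic
    have s1 : Plactic (p :: P ++ u :: q :: Q) (p :: u :: (P ++ q :: Q)) := e2.append_left [p]
    have s2 : Plactic (p :: u :: (P ++ q :: Q)) ([p, u, q] ++ (P ++ Q)) := e1.append_left [p, u]
    have s3 : Plactic ([p, u, q] ++ (P ++ Q)) ([u, p, q] ++ (P ++ Q)) := e3.symm.append_right _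
    have s4 : Plactic ([u, p, q] ++ (P ++ Q)) (u :: p :: (P ++ q :: Q)) := e1.symm.append_left [u, p]
    exact s1.trans (s2.trans (s3.trans s4))

theorem plactic_exchange {P P' Q : List ℕ} (hP : (P ++ P').Pairwise (· < ·))
    (hQ : Q.Pairwise (· < ·)) (h : Dominated Q P) :
    Plactic (P ++ P' ++ Q) (P ++ Q ++ P') := by
  induction P' generalizing P with
  | nil => simpa using Plactic.refl _
  | cons p P' ih =>
    have e1 := ih (P := P ++ [p]) (by simpa using hP) (h.append_right _)
    rw [List.pairwise_append] at hP
    have e2 := plactic_move_large hP.1 hQ h fun a ha => hP.2.2 a ha p (by simp)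
    have s1 : Plactic (P ++ p :: P' ++ Q) (P ++ [p] ++ Q ++ P') := by simpa using e1
    have s2 : Plactic (P ++ [p] ++ Q ++ P') (P ++ Q ++ p :: P') := by
      simpa using e2.symm.append_right P'
    exact s1.trans s2

/-- The word-level form of one ball `u` dropping a row: `Q` is moved left past `P'`, then `u` left
past `P'`, and finally `Q` right past `u P'`. -/
theorem plactic_drop {P P' Q Q' : List ℕ} {u : ℕ} (hP : (P ++ u :: P').Pairwise (· < ·))
    (hQ : (Q ++ u :: Q').Pairwise (· < ·)) (h : Dominated Q P) (h' : RowLE Q' P') :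
    Plactic ((P ++ P') ++ (Q ++ u :: Q')) ((P ++ u :: P') ++ (Q ++ Q')) := by
  have hP₁ : (P ++ P').Pairwise (· < ·) := hP.sublist (by simp)
  rw [List.pairwise_append, List.pairwise_cons] at hQ hP
  have e1 := plactic_exchange hP₁ hQ.1 h
  have e2 := plactic_move_small hP.2.1.2 hQ.2.1.2 h' hQ.2.1.1
  have e3 := plactic_exchange (List.pairwise_append.2 ⟨hP.1, List.pairwise_cons.2 hP.2.1, hP.2.2⟩)
    hQ.1 h
  have s1 : Plactic ((P ++ P') ++ (Q ++ u :: Q')) (P ++ Q ++ (P' ++ u :: Q')) := by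
    simpa using e1.append_right (u :: Q')
  have s2 : Plactic (P ++ Q ++ (P' ++ u :: Q')) (P ++ Q ++ (u :: (P' ++ Q'))) := e2.append_left _
  have s3 : Plactic (P ++ Q ++ (u :: (P' ++ Q'))) ((P ++ u :: P') ++ (Q ++ Q')) := by
    simpa using e3.symm.append_right Q'
  exact s1.trans (s2.trans s3)

/-! ### Dominance of rows and the bracketing rule -/

/-- The number of balls of a row in the columns `t, t + 1, …`. -/
def tailCard (A : Finset ℕ) (t : ℕ) : ℕ := (A.filter (t ≤ ·)).card

theorem countP_sort (A : Finset ℕ) (p : ℕ → Prop) [DecidablePred p] :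
    (A.sort (· ≤ ·)).countP (fun a => decide (p a)) = (A.filter p).card := by
  rw [← Multiset.coe_countP, Finset.sort_eq, Multiset.countP_eq_card_filter]
  simp [Finset.card_def, Finset.filter_val]

theorem sort_pairwise (A : Finset ℕ) : (A.sort (· ≤ ·)).Pairwise (· < ·) :=
  (Finset.sortedLT_sort A).pairwise

theorem sort_eq_of_sorted {l : List ℕ} {A : Finset ℕ} (hl : l.Pairwise (· < ·))
    (h : ∀ a, a ∈ l ↔ a ∈ A) : A.sort (· ≤ ·) = l := by
  obtain rfl : l.toFinset = A := by ext a; simp [h]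
  exact (List.toFinset_sort _ (hl.imp fun h => h.ne)).2 (hl.imp fun h => h.le)

/-- The balls of the row `A` can be matched injectively with balls weakly to the right in `B`. -/
def RowDominated (A B : Finset ℕ) : Prop := ∀ t, tailCard A t ≤ tailCard B t

theorem dominated_sort_iff {A B : Finset ℕ} :
    Dominated (A.sort (· ≤ ·)) (B.sort (· ≤ ·)) ↔ RowDominated A B :=
  forall_congr' fun t => by rw [countP_sort, countP_sort]; rfl

theorem tailCard_succ (A : Finset ℕ) (t : ℕ) :
    tailCard A t = tailCard A (t + 1) + if t ∈ A then 1 else 0 := by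
  have : A.filter (t ≤ ·) = A.filter (t + 1 ≤ ·) ∪ if t ∈ A then {t} else ∅ := by
    ext a
    split_ifs with h <;> simp only [Finset.mem_filter, Finset.mem_union, Finset.mem_singleton,
      Finset.notMem_empty, or_false]
    · constructor
      · rintro ⟨h1, h2⟩
        by_cases h3 : a = t
        · exact .inr h3
        · exact .inl ⟨h1, by omega⟩
      · rintro (⟨h1, h2⟩ | rfl)
        · exact ⟨h1, by omega⟩
        · exact ⟨h, le_rfl⟩
    · constructor
      · rintro ⟨h1, h2⟩
        have : a ≠ t := by rintro rfl; exact h h1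
        exact ⟨h1, by omega⟩
      · rintro ⟨h1, h2⟩
        exact ⟨h1, by omega⟩
  rw [tailCard, this, Finset.card_union_of_disjoint]
  · split_ifs <;> simp [tailCard]
  · split_ifs <;> simp

theorem tailCard_insert {A : Finset ℕ} {u : ℕ} (h : u ∉ A) (t : ℕ) :
    tailCard (insert u A) t = tailCard A t + if t ≤ u then 1 else 0 := by
  rw [tailCard, Finset.filter_insert]
  split_ifs with ht
  · rw [Finset.card_insert_of_notMem (by simp [h])]
    rfl
  · rfl

theorem tailCard_erase {A : Finset ℕ} {u : ℕ} (h : u ∈ A) (t : ℕ) :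
    tailCard A t = tailCard (A.erase u) t + if t ≤ u then 1 else 0 := by
  rw [← tailCard_insert (Finset.notMem_erase u A), Finset.insert_erase h]

theorem tailCard_eq_filter_lt (A : Finset ℕ) {t u : ℕ} (h : t ≤ u) :
    tailCard A t = tailCard (A.filter (· < u)) t + tailCard A u := by
  rw [tailCard, tailCard, tailCard, ← Finset.card_union_of_disjoint]
  · congr 1
    ext a
    simp only [Finset.mem_union, Finset.mem_filter]
    grind
  · rw [Finset.disjoint_left]
    simp only [Finset.mem_filter]
    grind

theorem tailCard_eq_filter_gt (A : Finset ℕ) {t u : ℕ} (h : u ≤ t) :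
    tailCard A (u + 1) =
      ((A.filter (u < ·)).filter (· ≤ t)).card + tailCard A (t + 1) := by
  rw [tailCard, tailCard, ← Finset.card_union_of_disjoint]
  · congr 1
    ext a
    simp only [Finset.mem_union, Finset.mem_filter]
    grind
  · rw [Finset.disjoint_left]
    simp only [Finset.mem_filter]
    grind

theorem unmatchedOpen_append (v w : List (Bool × ℕ)) (st : List ℕ) :
    unmatchedOpen (v ++ w) st = unmatchedOpen w (unmatchedOpen v st) := by
  induction v generalizing st with
  | nil => rfl
  | cons b v ih =>
    rcases b with ⟨_ | _, c⟩ <;> simp [unmatchedOpen, ih]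

/-- The parentheses of the columns in `l`. -/
def parOn (A B : Finset ℕ) (l : List ℕ) : List (Bool × ℕ) :=
  l.flatMap fun c =>
    (if c ∈ A then [(true, c)] else []) ++ (if c ∈ B then [(false, c)] else [])

/-- If every final part of a segment has at least as many closing as opening parentheses, all
openings of the segment are matched inside it, and only the surplus of closings acts on the stack.
-/
theorem unmatchedOpen_parOn {A B : Finset ℕ} {l : List ℕ} (hl : l.Pairwise (· < ·))
    (h : ∀ t, l.countP (fun a => decide (a ∈ A ∧ t ≤ a)) ≤
      l.countP (fun a => decide (a ∈ B ∧ t ≤ a))) (st : List ℕ) :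
    unmatchedOpen (parOn A B l) st =
      st.drop (l.countP (fun a => decide (a ∈ B)) - l.countP (fun a => decide (a ∈ A))) := by
  induction l generalizing st with
  | nil => rfl
  | cons c l ih =>
    rw [List.pairwise_cons] at hl
    have key : ∀ (S : Finset ℕ) (t : ℕ), t ≤ c + 1 →
        l.countP (fun a => decide (a ∈ S ∧ t ≤ a)) = l.countP (fun a => decide (a ∈ S)) := by
      intro S t ht
      refine List.countP_congr fun a ha => ?_
      have := hl.1 a ha
      have h2 : t ≤ a := by omega
      simp [h2]
    have h' : ∀ t, l.countP (fun a => decide (a ∈ A ∧ t ≤ a)) ≤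
        l.countP (fun a => decide (a ∈ B ∧ t ≤ a)) := by
      intro t
      -- For small `t` the instance `c + 1` of the hypothesis is used: it excludes column `c` but
      -- still counts all of `l`.
      by_cases ht : t ≤ c + 1
      · have := h (c + 1)
        simpa only [List.countP_cons, key _ _ ht, key _ _ le_rfl, decide_eq_true_eq,
          Nat.not_succ_le_self, and_false, if_false, add_zero] using this
      · have := h t
        have h2 : ¬ t ≤ c := by omega
        simpa [List.countP_cons, h2] using this
    have h0 := h 0
    have h1 := h' 0
    simp only [List.countP_cons, Nat.zero_le, and_true,
      decide_eq_true_eq] at h0 h1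
    have hpar : parOn A B (c :: l) = ((if c ∈ A then [(true, c)] else []) ++
      (if c ∈ B then [(false, c)] else [])) ++ parOn A B l := rfl
    rw [hpar, unmatchedOpen_append, ih hl.2 h', List.countP_cons, List.countP_cons]
    simp only [decide_eq_true_eq]
    split_ifs at h0 ⊢ with hA hB hB
    · simp only [List.cons_append, List.nil_append, unmatchedOpen, List.tail_cons]
      congr 1; omega
    · simp only [List.append_nil, unmatchedOpen]
      -- The parenthesis just opened at `c` is popped later: the total count over `c :: l` forces a
      -- positive surplus of closings in `l`.
      obtain ⟨d, hd⟩ : ∃ d, l.countP (fun a => decide (a ∈ B)) -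
        l.countP (fun a => decide (a ∈ A)) = d + 1 := ⟨_, (Nat.succ_pred_eq_of_pos (by omega)).symm⟩
      rw [hd, List.drop_succ_cons]
      congr 1; omega
    · simp only [List.nil_append, unmatchedOpen, ← List.drop_one, List.drop_drop]
      congr 1; omega
    · simp [unmatchedOpen]

theorem countP_mem_and_le {A : Finset ℕ} {l : List ℕ} (hl : l.Pairwise (· < ·))
    (h : ∀ a ∈ A, a ∈ l) (t : ℕ) :
    l.countP (fun a => decide (a ∈ A ∧ t ≤ a)) = tailCard A t := by
  rw [List.countP_eq_length_filter, tailCard,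
    ← List.toFinset_card_of_nodup ((hl.imp fun h => h.ne).filter _)]
  congr 1
  ext a
  simp only [List.mem_toFinset, List.mem_filter, decide_eq_true_eq, Finset.mem_filter]
  exact ⟨fun h => h.2, fun h' => ⟨h a h'.1, h'⟩⟩

theorem unmatchedAbove_of_rowDominated {A B : Finset ℕ} (h : RowDominated A B) :
    unmatchedAbove A B = ∅ := by
  have hl := sort_pairwise (A ∪ B)
  have := unmatchedOpen_parOn (A := A) (B := B) hl (fun t => by
    rw [countP_mem_and_le hl (by simp +contextual), countP_mem_and_le hl (by simp +contextual)]
    exact h t) []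
  rw [unmatchedAbove, par, ← parOn, this]
  simp

/-- `A` has exactly one ball that is unmatched above, namely `u`. -/
structure HasExcess (A B : Finset ℕ) (u : ℕ) : Prop where
  le_succ : ∀ t, tailCard A t ≤ tailCard B t + 1
  le : ∀ t, u < t → tailCard A t ≤ tailCard B t
  lt : tailCard B u < tailCard A u

/-- Take for `u` the largest column at which the tail count violates dominance. Beyond `v` the tails
of `A` and `X` agree, so `u ≤ v`, and a single extra ball creates an excess of at most one. -/
theorem exists_hasExcess {A B X : Finset ℕ} {v : ℕ} (hv : v ∉ X) (hA : A = insert v X)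
    (hX : RowDominated X B) (h : ¬ RowDominated A B) : ∃ u ≤ v, HasExcess A B u := by
  subst hA
  have hle : ∀ t, v < t → tailCard (insert v X) t ≤ tailCard B t := fun t ht => by
    rw [tailCard_insert hv, if_neg (by omega)]
    exact hX t
  have hex : ∃ t, tailCard B t < tailCard (insert v X) t := by
    by_contra! hcon
    exact h hcon
  have hbd : ∀ t, tailCard B t < tailCard (insert v X) t → t ≤ v := fun t ht => by
    by_contra! hcon
    have := hle t hcon
    omega
  obtain ⟨t₀, ht₀⟩ := hex
  have hspec := Nat.findGreatest_spec (P := fun t => tailCard B t < tailCard (insert v X) t)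
    (hbd t₀ ht₀) ht₀
  refine ⟨_, hbd _ hspec, fun t => ?_, fun t ht => ?_, hspec⟩
  · have := hX t
    rw [tailCard_insert hv]
    split_ifs <;> omega
  · by_contra! hcon
    exact absurd (Nat.le_findGreatest (P := fun t => tailCard B t < tailCard (insert v X) t)
      (hbd t hcon) hcon) (by omega)

namespace HasExcess

variable {A B : Finset ℕ} {u : ℕ}

theorem facts (h : HasExcess A B u) : u ∈ A ∧ u ∉ B ∧ tailCard A (u + 1) = tailCard B (u + 1) := by
  have h1 := h.lt
  have h2 := h.le (u + 1) (by omega)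
  rw [tailCard_succ A u, tailCard_succ B u] at h1
  split_ifs at h1 with hB hA <;> first | omega | exact ⟨‹_›, ‹_›, by omega⟩

theorem tailCard_eq (h : HasExcess A B u) : tailCard A u = tailCard B u + 1 := by
  have := h.le_succ u
  have := h.lt
  omega

/-- The parenthesis word is cut at `u`, and both sides satisfy the hypothesis of
`unmatchedOpen_parOn`. The left part leaves the stack empty; the right part is balanced, so it
leaves `u` on the stack. -/
theorem unmatchedAbove_eq (h : HasExcess A B u) : unmatchedAbove A B = {u} := by
  obtain ⟨hA, hB, heq⟩ := h.facts
  obtain ⟨l₁, l₂, hs⟩ := List.mem_iff_append.1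
    (show u ∈ (A ∪ B).sort (· ≤ ·) by simp [hA])
  have hl := sort_pairwise (A ∪ B)
  have hcA := countP_mem_and_le (A := A) hl (by simp +contextual)
  have hcB := countP_mem_and_le (A := B) hl (by simp +contextual)
  have hpar : par A B = parOn A B l₁ ++ ((true, u) :: parOn A B l₂) := by
    rw [par, ← parOn, hs, parOn, List.flatMap_append, List.flatMap_cons, if_pos hA, if_neg hB]
    rfl
  simp only [hs, List.countP_append, List.countP_cons] at hcA hcB
  rw [hs, List.pairwise_append, List.pairwise_cons] at hl
  have k1 : ∀ (S : Finset ℕ) (t : ℕ), u < t →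
      l₁.countP (fun a => decide (a ∈ S ∧ t ≤ a)) = 0 := by
    intro S t ht
    rw [List.countP_eq_zero]
    intro a ha
    have := hl.2.2 a ha u (by simp)
    simp; omega
  have k2 : ∀ (S : Finset ℕ) (t : ℕ), t ≤ u + 1 →
      l₂.countP (fun a => decide (a ∈ S ∧ t ≤ a)) = l₂.countP (fun a => decide (a ∈ S)) := by
    intro S t ht
    refine List.countP_congr fun a ha => ?_
    have := hl.2.1.1 a ha
    have h2 : t ≤ a := by omega
    simp [h2]
  have g1 : ∀ t, l₁.countP (fun a => decide (a ∈ A ∧ t ≤ a)) ≤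
      l₁.countP (fun a => decide (a ∈ B ∧ t ≤ a)) := by
    intro t
    by_cases ht : u < t
    · rw [k1 _ _ ht, k1 _ _ ht]
    · have h1 := hcA t
      have h2 := hcB t
      have h3 := hcA (u + 1)
      have h4 := hcB (u + 1)
      have h5 := h.le_succ t
      have h6 : t ≤ u := by omega
      rw [k1 _ _ (by omega), k2 _ _ le_rfl] at h3 h4
      simp only [decide_eq_true_eq, Nat.not_succ_le_self, and_false, if_false, zero_add,
        add_zero] at h3 h4
      rw [k2 _ _ (by omega)] at h1 h2
      simp only [decide_eq_true_eq, hA, hB, h6, and_true, if_true, if_false] at h1 h2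
      omega
  have g2 : ∀ t, l₂.countP (fun a => decide (a ∈ A ∧ t ≤ a)) ≤
      l₂.countP (fun a => decide (a ∈ B ∧ t ≤ a)) := by
    intro t
    have h1 := hcA t
    have h2 := hcB t
    have h3 := hcA (u + 1)
    have h4 := hcB (u + 1)
    by_cases ht : u < t
    · have h5 := h.le t ht
      rw [k1 _ _ ht] at h1 h2
      simp only [decide_eq_true_eq, show ¬ t ≤ u by omega, and_false, if_false, zero_add,
        add_zero] at h1 h2
      omega
    · rw [k1 _ _ (by omega), k2 _ _ le_rfl] at h3 h4
      simp only [decide_eq_true_eq, Nat.not_succ_le_self, and_false, if_false, zero_add,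
        add_zero] at h3 h4
      rw [k2 _ _ (by omega), k2 _ _ (by omega)]
      omega
  have h3 := hcA (u + 1)
  have h4 := hcB (u + 1)
  rw [k1 _ _ (by omega), k2 _ _ le_rfl] at h3 h4
  simp only [decide_eq_true_eq, Nat.not_succ_le_self, and_false, if_false, zero_add,
    add_zero] at h3 h4
  rw [unmatchedAbove, hpar, unmatchedOpen_append, unmatchedOpen_parOn hl.1 g1, unmatchedOpen,
    unmatchedOpen_parOn hl.2.1.2 g2, h3, h4, heq]
  simp

/-- Both rows are cut at `u`. To the left, the excess of one at `u` absorbs the slack in `le_succ`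
and leaves plain dominance. To the right, the two rows have equally many balls, so dominance of
tails turns into the opposite inequality for initial counts, which is `RowLE`. -/
theorem plactic (h : HasExcess A B u) :
    Plactic (B.sort (· ≤ ·) ++ A.sort (· ≤ ·))
      ((B ∪ {u}).sort (· ≤ ·) ++ (A \ {u}).sort (· ≤ ·)) := by
  obtain ⟨hA, hB, heq⟩ := h.facts
  have split : ∀ S : Finset ℕ, ((S.filter (· < u)).sort (· ≤ ·) ++
      u :: (S.filter (u < ·)).sort (· ≤ ·)).Pairwise (· < ·) := by
    intro S
    rw [List.pairwise_append, List.pairwise_cons]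
    refine ⟨sort_pairwise _, ⟨by simp, sort_pairwise _⟩, ?_⟩
    simp only [Finset.mem_sort, List.mem_cons, Finset.mem_filter]
    grind
  have split' : ∀ S : Finset ℕ, ((S.filter (· < u)).sort (· ≤ ·) ++
      (S.filter (u < ·)).sort (· ≤ ·)).Pairwise (· < ·) :=
    fun S => (split S).sublist (by simp)
  have e1 : B.sort (· ≤ ·) = (B.filter (· < u)).sort (· ≤ ·) ++
      (B.filter (u < ·)).sort (· ≤ ·) := sort_eq_of_sorted (split' B) fun a => by
    simp only [List.mem_append, Finset.mem_sort, Finset.mem_filter]; grind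
  have e2 : A.sort (· ≤ ·) = (A.filter (· < u)).sort (· ≤ ·) ++
      u :: (A.filter (u < ·)).sort (· ≤ ·) := sort_eq_of_sorted (split A) fun a => by
    simp only [List.mem_append, List.mem_cons, Finset.mem_sort, Finset.mem_filter]; grind
  have e3 : (B ∪ {u}).sort (· ≤ ·) = (B.filter (· < u)).sort (· ≤ ·) ++
      u :: (B.filter (u < ·)).sort (· ≤ ·) := sort_eq_of_sorted (split B) fun a => by
    simp only [List.mem_append, List.mem_cons, Finset.mem_sort, Finset.mem_filter,
      Finset.mem_union, Finset.mem_singleton]; grind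
  have e4 : (A \ {u}).sort (· ≤ ·) = (A.filter (· < u)).sort (· ≤ ·) ++
      (A.filter (u < ·)).sort (· ≤ ·) := sort_eq_of_sorted (split' A) fun a => by
    simp only [List.mem_append, Finset.mem_sort, Finset.mem_filter,
      Finset.mem_sdiff, Finset.mem_singleton]; grind
  rw [e1, e2, e3, e4]
  refine plactic_drop (split B) (split A) (dominated_sort_iff.2 fun t => ?_) fun t => ?_
  · by_cases ht : t ≤ u
    · have h1 := tailCard_eq_filter_lt A ht
      have h2 := tailCard_eq_filter_lt B ht
      have h3 := h.le_succ t
      have h4 := h.tailCard_eq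
      omega
    · rw [tailCard, Finset.card_eq_zero.2]
      · omega
      · ext a
        simp only [Finset.mem_filter, Finset.notMem_empty]; grind
  · rw [countP_sort, countP_sort]
    by_cases ht : u ≤ t
    · have h1 := tailCard_eq_filter_gt A ht
      have h2 := tailCard_eq_filter_gt B ht
      have h3 := h.le (t + 1) (by omega)
      omega
    · rw [Finset.card_eq_zero.2]
      · omega
      · ext a
        simp only [Finset.mem_filter, Finset.notMem_empty]; grind

end HasExcess

/-! ### Insertion into nonwrapping multiline queues -/

/-- Every row is dominated by the row below it. -/
def RowChain (M : List (Finset ℕ)) : Prop := M.IsChain fun B A => RowDominated A B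

theorem rw_append (M N : List (Finset ℕ)) : rw (M ++ N) = rw M ++ rw N := List.flatMap_append

theorem rw_cons (B : Finset ℕ) (M : List (Finset ℕ)) :
    rw (B :: M) = B.sort (· ≤ ·) ++ rw M := List.flatMap_cons

theorem RowDominated.trans {A B C : Finset ℕ} (h : RowDominated A B) (h' : RowDominated B C) :
    RowDominated A C := fun t => (h t).trans (h' t)

theorem rowDominated_empty (B : Finset ℕ) : RowDominated ∅ B := fun t => by simp [tailCard]

theorem RowChain.getD {M : List (Finset ℕ)} (h : RowChain M) (i : ℕ) :
    RowDominated (M.getD (i + 1) ∅) (M.getD i ∅) := by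
  by_cases hi : i + 1 < M.length
  · rw [List.getD_eq_getElem _ _ hi, List.getD_eq_getElem _ _ (by omega)]
    exact List.isChain_iff_getElem.1 h i hi
  · rw [List.getD_eq_default _ _ (by omega)]
    exact rowDominated_empty _

theorem eStar_eq_self {i : ℕ} {M : List (Finset ℕ)}
    (h : RowDominated (M.getD i ∅) (M.getD (i - 1) ∅)) : eStar i M = M := by
  have key : ∀ j, M.set j (M.getD j ∅) = M := by
    intro j
    by_cases hj : j < M.length
    · rw [List.getD_eq_getElem _ _ hj, List.set_getElem_self]
    · exact List.set_eq_of_length_le (by omega)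
  rw [eStar, unmatchedAbove_of_rowDominated h]
  simp only [Finset.sdiff_empty, Finset.union_empty, key]

theorem eStarRange_eq_self {b : ℕ} {M : List (Finset ℕ)}
    (h : ∀ i < b, RowDominated (M.getD (i + 1) ∅) (M.getD i ∅)) : eStarRange b M = M := by
  induction b with
  | zero => rfl
  | succ b ih =>
    rw [eStarRange, eStar_eq_self (by simpa using h b (by omega)), ih fun i hi => h i (by omega)]

theorem collapseSteps_eq_self {k : ℕ} {M : List (Finset ℕ)}
    (h : ∀ i < k, RowDominated (M.getD (i + 1) ∅) (M.getD i ∅)) : collapseSteps k M = M := by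
  induction k with
  | zero => rfl
  | succ k ih => rw [collapseSteps, ih fun i hi => h i (by omega), eStarRange_eq_self h]

theorem eStar_append (M N : List (Finset ℕ)) (B A : Finset ℕ) :
    eStar (M.length + 1) (M ++ B :: A :: N) =
      M ++ (B ∪ unmatchedAbove A B) :: (A \ unmatchedAbove A B) :: N := by
  rw [eStar]
  simp [List.getD_eq_getElem?_getD]

/-- Passing from `X` to `A \ {u}` exchanges `u` for a ball `v ≥ u`, so no tail count decreases; and
deleting `u` removes the excess over `B`. -/
theorem HasExcess.sdiff {A B X : Finset ℕ} {u v : ℕ} (h : HasExcess A B u) (hv : v ∉ X)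
    (hA : A = insert v X) (huv : u ≤ v) :
    RowDominated X (A \ {u}) ∧ RowDominated (A \ {u}) B := by
  have huA := h.facts.1
  constructor <;> intro t <;> have h1 := tailCard_erase huA t <;>
    rw [Finset.sdiff_singleton_eq_erase]
  · have h2 := tailCard_insert hv t
    rw [← hA] at h2
    split_ifs at h1 h2 <;> omega
  · split_ifs at h1 with ht
    · have := h.le_succ t
      omega
    · have := h.le t (by omega)
      omega

/-- The invariant of a collapsing sweep: the array is a dominance chain except for one surplus ball
`v` in the row `A`. Either `A` is dominated already and the rest of the sweep does nothing, or
exactly one ball drops and becomes the surplus ball of the next row down. -/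
theorem eStarRange_spec {M N : List (Finset ℕ)} {A B X : Finset ℕ} {v : ℕ} (hM : RowChain (M ++ [B]))
    (hN : RowChain (X :: N)) (hv : v ∉ X) (hA : A = insert v X) (hX : RowDominated X B) :
    RowChain (eStarRange (M.length + 1) (M ++ B :: A :: N)) ∧
      Plactic (rw (M ++ B :: A :: N)) (rw (eStarRange (M.length + 1) (M ++ B :: A :: N))) := by
  have hXA : RowDominated X A := fun t => by
    rw [hA, tailCard_insert hv]
    omega
  have chainTop : ∀ Y, RowDominated X Y → RowChain (Y :: N) := by
    intro Y hY
    cases N with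
    | nil => exact List.isChain_singleton _
    | cons D N =>
      rw [RowChain, List.isChain_cons_cons] at hN ⊢
      exact ⟨hN.1.trans hY, hN.2⟩
  by_cases hAB : RowDominated A B
  · have hc : RowChain (M ++ B :: A :: N) :=
      List.isChain_split.2 ⟨hM, List.isChain_cons_cons.2 ⟨hAB, chainTop A hXA⟩⟩
    rw [eStarRange_eq_self fun i _ => hc.getD i]
    exact ⟨hc, Plactic.refl _⟩
  · obtain ⟨u, huv, hu⟩ := exists_hasExcess hv hA hX hAB
    obtain ⟨hXu, huB⟩ := hu.sdiff hv hA huv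
    have huB' := hu.facts.2.1
    have hc := chainTop _ hXu
    have hpl : Plactic (rw (M ++ B :: A :: N)) (rw (M ++ (B ∪ {u}) :: (A \ {u}) :: N)) := by
      simpa [rw_append, rw_cons] using (hu.plactic.append_left (rw M)).append_right (rw N)
    rw [eStarRange, eStar_append, hu.unmatchedAbove_eq]
    rcases List.eq_nil_or_concat' M with rfl | ⟨M, B', rfl⟩
    · refine ⟨List.isChain_cons_cons.2 ⟨huB.trans fun t => ?_, hc⟩, hpl⟩
      exact Finset.card_le_card (Finset.filter_subset_filter _ Finset.subset_union_left)
    · have hM' : RowChain (M ++ [B']) := hM.left_of_append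
      have hB : RowDominated B B' := by
        have := hM
        rw [RowChain, List.append_assoc] at this
        exact (List.isChain_cons_cons.1 this.right_of_append).1
      -- One row lower, `B ∪ {u}` is the row with the surplus ball `u`, and `B` plays the part of
      -- `X`.
      obtain ⟨h1, h2⟩ := eStarRange_spec hM' (List.isChain_cons_cons.2 ⟨huB, hc⟩) huB'
        (A := B ∪ {u}) (by ext a; simp) hB
      simp only [List.append_assoc, List.cons_append, List.nil_append, List.length_append,
        List.length_singleton] at h1 h2 hpl ⊢
      exact ⟨h1, hpl.trans h2⟩
  termination_by M.length

/-- The nonwrapping multiline queues without empty rows, in terms of dominance. -/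
structure Nonwrapping (M : List (Finset ℕ)) : Prop where
  chain : RowChain M
  nonempty : ∀ B ∈ M, B ≠ ∅

theorem Nonwrapping.nil : Nonwrapping [] := ⟨List.isChain_nil, by simp⟩

theorem RowDominated.nonempty {A B : Finset ℕ} (h : RowDominated A B) (hA : A ≠ ∅) : B ≠ ∅ := by
  rintro rfl
  have := h 0
  simp [tailCard] at this
  exact hA this

theorem RowChain.nonwrapping {M : List (Finset ℕ)} {B : Finset ℕ} (h : RowChain (M ++ [B]))
    (hB : B ≠ ∅) : Nonwrapping (M ++ [B]) := by
  refine ⟨h, ?_⟩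
  induction M using List.reverseRecOn generalizing B with
  | nil => simpa using hB
  | append_singleton M A ih =>
    have hA : RowDominated B A := by
      have := h
      rw [RowChain, List.append_assoc] at this
      exact (List.isChain_cons_cons.1 this.right_of_append).1
    have := ih h.left_of_append (hA.nonempty hB)
    intro D hD
    rcases List.mem_append.1 hD with hD | hD
    · exact this D hD
    · rw [List.mem_singleton] at hD
      rwa [hD]

theorem rdropWhile_spec {M : List (Finset ℕ)} (h : RowChain M) :
    Nonwrapping (M.rdropWhile fun B => decide (B = ∅)) ∧
      rw (M.rdropWhile fun B => decide (B = ∅)) = rw M := by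
  induction M using List.reverseRecOn with
  | nil => exact ⟨.nil, rfl⟩
  | append_singleton M B ih =>
    by_cases hB : B = ∅
    · rw [List.rdropWhile_concat_pos _ _ _ (by simpa using hB)]
      obtain ⟨h1, h2⟩ := ih h.left_of_append
      refine ⟨h1, ?_⟩
      rw [h2, rw_append, hB]
      simp [rw]
    · rw [List.rdropWhile_concat_neg _ _ _ (by simpa using hB)]
      exact ⟨h.nonwrapping hB, rfl⟩

theorem insertMLQ_spec {M : List (Finset ℕ)} (h : RowChain M) (k : ℕ) :
    Nonwrapping (insertMLQ k M) ∧ Plactic (rw M ++ [k]) (rw (insertMLQ k M)) := by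
  have hk : rw M ++ [k] = rw (M ++ [{k}]) := by
    rw [rw_append]
    simp [rw]
  have key : RowChain (collapseSteps ((M ++ [{k}]).length - 1) (M ++ [{k}])) ∧
      Plactic (rw (M ++ [{k}])) (rw (collapseSteps ((M ++ [{k}]).length - 1) (M ++ [{k}]))) := by
    rcases List.eq_nil_or_concat' M with rfl | ⟨M, B, rfl⟩
    · exact ⟨List.isChain_singleton _, Plactic.refl _⟩
    · have hlen : (M ++ [B] ++ [{k}]).length - 1 = M.length + 1 := by simp
      -- All sweeps but the last involve only rows of the given chain, so they act trivially. The
      -- last one starts with `{k}` as the row with a surplus ball over `X = ∅`.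
      have e : collapseSteps M.length (M ++ [B] ++ [{k}]) = M ++ [B] ++ [{k}] := by
        refine collapseSteps_eq_self fun i hi => ?_
        rw [List.getD_append (M ++ [B]) [{k}] _ _ (by simpa using hi),
          List.getD_append (M ++ [B]) [{k}] _ _ (by simp; omega)]
        exact h.getD i
      rw [hlen, collapseSteps, e]
      simpa using eStarRange_spec (M := M) (B := B) (A := {k}) (X := ∅) (v := k) (N := []) h
        (List.isChain_singleton _) (by simp) (by simp) (rowDominated_empty _)
  obtain ⟨h1, h2⟩ := rdropWhile_spec key.1
  rw [hk, insertMLQ, rhoN, h2]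
  exact ⟨h1, key.2⟩

theorem tab_insertMLQ {M : List (Finset ℕ)} (h : RowChain M) (k : ℕ) :
    tab (insertMLQ k M) = insertTab k (tab M) := by
  rw [tab, ← (insertMLQ_spec h k).2.Icol_eq, Icol_append]
  rfl

theorem rho_spec (w : List ℕ) : Nonwrapping (rho w) ∧ tab (rho w) = Icol w := by
  induction w using List.reverseRecOn with
  | nil => exact ⟨.nil, rfl⟩
  | append_singleton w k ih =>
    have : rho (w ++ [k]) = insertMLQ k (rho w) := List.foldl_append
    rw [this, tab_insertMLQ ih.1.chain, ih.2, Icol_append]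
    exact ⟨(insertMLQ_spec ih.1.chain k).1, rfl⟩

/-! ### Tableaux as lists of columns -/

/-- The list of columns of a semistandard tableau with natural entries. -/
structure IsTableau (T : List (List ℕ)) : Prop where
  sorted : ∀ C ∈ T, C.Pairwise (· < ·)
  nonempty : ∀ C ∈ T, C ≠ []
  chain : T.IsChain RowLE

theorem bumpColumn_countP (x : ℕ) (C : List ℕ) (p : ℕ → Bool) :
    (bumpColumn x C).1.countP p + (bumpColumn x C).2.toList.countP p =
      C.countP p + if p x then 1 else 0 := by
  rw [← List.countP_append, (bumpColumn_perm x C).countP_eq, List.countP_cons]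

theorem RowLE.trans {P Q R : List ℕ} (h : RowLE P Q) (h' : RowLE Q R) : RowLE P R :=
  fun t => (h' t).trans (h t)

instance : IsTrans (List ℕ) RowLE := ⟨fun _ _ _ => RowLE.trans⟩

theorem rowLE_bumpColumn {x : ℕ} {C : List ℕ} (hC : C.Pairwise (· < ·)) :
    RowLE (bumpColumn x C).1 C := by
  intro t
  have h := bumpColumn_countP x C (fun a => decide (a ≤ t))
  rcases hy : (bumpColumn x C).2 with _ | y
  · simp [hy] at h
    omega
  · have hxy := (bumpColumn_some hC hy).1
    simp only [hy, Option.toList_some, List.countP_cons, List.countP_nil, decide_eq_true_eq] at h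
    split_ifs at h <;> omega

/-- The count of entries `≤ t` never decreases in `C`, and in `D` it grows only for `y ≤ t`, with `t
< z` if some `z` is bumped. In that range `D` has no entries in `[y, t]` while `C` contains `y`, so
there was room for one more. -/
theorem RowLE.bumpColumn {x y : ℕ} {C D : List ℕ} (h : RowLE C D) (hC : C.Pairwise (· < ·))
    (hD : D.Pairwise (· < ·)) (hy : (bumpColumn x C).2 = some y) :
    RowLE (bumpColumn x C).1 (bumpColumn y D).1 := by
  intro t
  have h1 := h t
  have h2 := bumpColumn_countP x C (fun a => decide (a ≤ t))
  have h3 := bumpColumn_countP y D (fun a => decide (a ≤ t))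
  obtain ⟨hxy, hyC, -⟩ := bumpColumn_some hC hy
  have key : y ≤ t → (∀ d ∈ D, d ≤ t → d < y) → D.countP (fun a => decide (a ≤ t)) + 1 ≤
      C.countP (fun a => decide (a ≤ t)) := by
    intro hyt hd
    have e1 : D.countP (fun a => decide (a ≤ t)) = D.countP (fun a => decide (a < y)) :=
      List.countP_congr fun d hdD => by
        have := hd d hdD
        simp only [decide_eq_true_eq]
        omega
    have e2 : D.countP (fun a => decide (a < y)) ≤ C.countP (fun a => decide (a < y)) := by
      cases y with
      | zero => simp
      | succ y => simpa only [Nat.lt_succ_iff] using h y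
    obtain ⟨l, l', rfl⟩ := List.mem_iff_append.1 hyC
    have mono : ∀ l : List ℕ, l.countP (fun a => decide (a < y)) ≤
        l.countP (fun a => decide (a ≤ t)) := fun l => List.countP_mono_left fun a _ => by
      simp only [decide_eq_true_eq]; omega
    have h4 := mono l
    have h5 := mono l'
    simp only [List.countP_append, List.countP_cons, decide_eq_true_eq, lt_irrefl, if_false, hyt,
      if_true] at e2 ⊢
    omega
  simp only [hy, Option.toList_some, List.countP_cons, List.countP_nil, decide_eq_true_eq] at h2
  rcases hz : (MultilineQueue.bumpColumn y D).2 with _ | z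
  · have hlt := lt_of_bumpColumn_none hz
    simp only [hz, Option.toList_none, List.countP_nil, decide_eq_true_eq] at h3
    by_cases hyt : y ≤ t
    · have := key hyt fun d hd _ => hlt d hd
      split_ifs at h2 h3 <;> omega
    · split_ifs at h2 h3 <;> omega
  · obtain ⟨hyz, -, hmin⟩ := bumpColumn_some hD hz
    simp only [hz, Option.toList_some, List.countP_cons, List.countP_nil, decide_eq_true_eq] at h3
    by_cases hyt : y ≤ t ∧ t < z
    · have := key hyt.1 fun d hd hdt => by
        by_contra hcon
        have := hmin d hd (by omega)
        omega
      split_ifs at h2 h3 <;> omega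
    · split_ifs at h2 h3 <;> omega

theorem IsTableau.nil : IsTableau [] := ⟨by simp, by simp, List.isChain_nil⟩

theorem isTableau_cons {C : List ℕ} {T : List (List ℕ)} :
    IsTableau (C :: T) ↔ C.Pairwise (· < ·) ∧ C ≠ [] ∧ RowLE C (T.headD []) ∧ IsTableau T := by
  constructor
  · rintro ⟨h1, h2, h3⟩
    simp only [List.mem_cons, forall_eq_or_imp] at h1 h2
    cases T with
    | nil => exact ⟨h1.1, h2.1, rowLE_nil C, .nil⟩
    | cons D T =>
      rw [List.isChain_cons_cons] at h3
      exact ⟨h1.1, h2.1, h3.1, h1.2, h2.2, h3.2⟩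
  · rintro ⟨h1, h2, h3, h4, h5, h6⟩
    refine ⟨List.forall_mem_cons.2 ⟨h1, h4⟩, List.forall_mem_cons.2 ⟨h2, h5⟩, ?_⟩
    cases T with
    | nil => exact List.isChain_singleton C
    | cons D T => exact List.isChain_cons_cons.2 ⟨h3, h6⟩

theorem headD_insertTab (x : ℕ) (T : List (List ℕ)) :
    (insertTab x T).headD [] = (bumpColumn x (T.headD [])).1 := by
  cases T with
  | nil => rfl
  | cons C T =>
    rw [insertTab]
    rcases h : bumpColumn x C with ⟨C', _ | y⟩ <;> simp [h]

theorem IsTableau.insertTab {T : List (List ℕ)} (hT : IsTableau T) (x : ℕ) :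
    IsTableau (insertTab x T) := by
  induction T generalizing x with
  | nil => exact isTableau_cons.2 ⟨by simp, by simp, rowLE_nil _, .nil⟩
  | cons C T ih =>
    obtain ⟨h1, h2, h3, h4⟩ := isTableau_cons.1 hT
    have h5 := bumpColumn_sorted (x := x) h1
    have h6 := List.ne_nil_of_mem (self_mem_bumpColumn x C)
    have h7 := rowLE_bumpColumn (x := x) h1
    have hD : (T.headD []).Pairwise (· < ·) := by
      cases T with
      | nil => simp
      | cons D T => exact h4.sorted D (by simp)
    have h8 := fun y hy => h3.bumpColumn (x := x) (y := y) h1 hD hy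
    rw [MultilineQueue.insertTab]
    rcases h : bumpColumn x C with ⟨C', _ | y⟩ <;> simp only [h] at h5 h6 h7 h8
    · exact isTableau_cons.2 ⟨h5, h6, h7.trans h3, h4⟩
    · refine isTableau_cons.2 ⟨h5, h6, ?_, ih h4 y⟩
      rw [headD_insertTab]
      exact h8 y rfl

theorem isTableau_Icol (w : List ℕ) : IsTableau (Icol w) := by
  induction w using List.reverseRecOn with
  | nil => exact .nil
  | append_singleton w k ih =>
    rw [Icol_append]
    exact ih.insertTab k

/-- Each letter of `P` replaces the entry of `Q` at its own height, so a whole column is pushed one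
place to the right; this is what makes `Icol` rebuild a tableau column by column. -/
theorem bumpWord_eq_of_rowLE {P Q : List ℕ} (hP : P.Pairwise (· < ·)) (hQ : Q.Pairwise (· < ·))
    (h : RowLE P Q) : bumpWord Q P = (P, Q) := by
  induction P generalizing Q with
  | nil =>
    have : Q = [] := by simpa using h.length_le
    subst this
    rfl
  | cons p P ih =>
    cases Q with
    | nil => simpa using bumpWord_of_sorted (C := []) hP
    | cons q Q =>
      obtain ⟨hpq, h'⟩ := (rowLE_cons_iff hP hQ).1 h
      rw [List.pairwise_cons] at hP hQ
      rw [bumpWord, bumpColumn, if_pos hpq, bumpWord_cons_of_forall_lt hP.1, ih hP.2 hQ.2 h']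
      rfl

theorem IsTableau.insertWord_column {C : List ℕ} {T : List (List ℕ)} (h : IsTableau (C :: T)) :
    insertWord T C = C :: T := by
  induction T generalizing C with
  | nil =>
    obtain ⟨h1, h2, -, -⟩ := isTableau_cons.1 h
    obtain ⟨c, C, rfl⟩ := List.exists_cons_of_ne_nil h2
    have : insertWord [] (c :: C) = insertWord [[c]] C := rfl
    rw [this, insertWord_cons, bumpWord_of_sorted (by simpa using h1)]
    rfl
  | cons D T ih =>
    obtain ⟨h1, h2, h3, h4⟩ := isTableau_cons.1 h
    rw [insertWord_cons, bumpWord_eq_of_rowLE h1 (h4.sorted D (by simp)) h3, ih h4]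

theorem IsTableau.Icol_revcrw {T : List (List ℕ)} (h : IsTableau T) : Icol (revcrw T) = T := by
  induction T with
  | nil => rfl
  | cons C T ih =>
    have : revcrw (C :: T) = revcrw T ++ C := by simp [revcrw, crw]
    rw [this, Icol_append, ih (isTableau_cons.1 h).2.2.2, h.insertWord_column]

theorem insertTab_flatten_perm (x : ℕ) (T : List (List ℕ)) :
    (insertTab x T).flatten.Perm (x :: T.flatten) := by
  induction T generalizing x with
  | nil => simp [insertTab]
  | cons C T ih =>
    have hp := bumpColumn_perm x C
    rw [insertTab]
    rcases h : bumpColumn x C with ⟨C', _ | y⟩ <;> simp only [h] at hp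
    · simpa using hp.append_right T.flatten
    · rw [List.flatten_cons]
      refine ((ih y).append_left C').trans ?_
      simpa using hp.append_right T.flatten

theorem Icol_flatten_perm (w : List ℕ) : (Icol w).flatten.Perm w := by
  induction w using List.reverseRecOn with
  | nil => exact List.Perm.refl _
  | append_singleton w k ih =>
    rw [Icol_append]
    exact (insertTab_flatten_perm k _).trans
      ((ih.cons k).trans (List.perm_append_comm (l₁ := [k])))

theorem tabWeight_tab (M : List (Finset ℕ)) : tabWeight (tab M) = mlqWeight M := by
  rw [tabWeight, tab, ((Icol_flatten_perm (rw M)).map _).prod_eq, mlqWeight]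
  induction M with
  | nil => rfl
  | cons B M ih =>
    rw [rw_cons, List.map_append, List.prod_append, ih, List.map_cons, List.prod_cons]
    congr 1
    rw [← Multiset.prod_coe, ← Multiset.map_coe, Finset.sort_eq]
    rfl

theorem rowLE_iff_getD {P Q : List ℕ} (hP : P.Pairwise (· < ·)) (hQ : Q.Pairwise (· < ·)) :
    RowLE P Q ↔ Q.length ≤ P.length ∧ ∀ i < Q.length, P.getD i 0 ≤ Q.getD i 0 := by
  induction Q generalizing P with
  | nil => simp [rowLE_nil]
  | cons q Q ih =>
    cases P with
    | nil => exact ⟨fun h => absurd h.length_le (by simp), fun h => by simp at h⟩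
    | cons p P =>
      rw [rowLE_cons_iff hP hQ, ih (List.pairwise_cons.1 hP).2 (List.pairwise_cons.1 hQ).2]
      constructor
      · rintro ⟨h1, h2, h3⟩
        refine ⟨by simpa using h2, fun i hi => ?_⟩
        cases i with
        | zero => simpa using h1
        | succ i => simpa using h3 i (by simpa using hi)
      · rintro ⟨h1, h2⟩
        exact ⟨by simpa using h2 0 (by simp), by simpa using h1,
          fun i hi => by simpa using h2 (i + 1) (by simpa using hi)⟩

theorem exists_columns_iff (lam : YoungDiagram) (p : ℕ → Prop) (C : List (List ℕ)) :
    (∃ T : SemistandardYoungTableau lam, (∀ i j, (i, j) ∈ lam → p (T i j)) ∧ C = columns T) ↔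
      IsTableau C ∧ C.map List.length = (List.range (lam.rowLen 0)).map lam.colLen ∧
        ∀ a ∈ C.flatten, p a := by
  have zero_lt : ∀ j < lam.rowLen 0, 0 < lam.colLen j := fun j hj =>
    YoungDiagram.mem_iff_lt_colLen.1 (YoungDiagram.mem_iff_lt_rowLen.2 hj)
  constructor
  · rintro ⟨T, hT, rfl⟩
    have hs : ∀ j, ((List.range (lam.colLen j)).map fun i => T i j).Pairwise (· < ·) := by
      intro j
      rw [List.pairwise_map]
      refine List.pairwise_lt_range.imp_of_mem fun _ hb hab => ?_
      exact T.col_strict hab (YoungDiagram.mem_iff_lt_colLen.2 (List.mem_range.1 hb))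
    refine ⟨⟨?_, ?_, ?_⟩, ?_, ?_⟩
    · simp only [columns, List.mem_map]
      rintro _ ⟨j, -, rfl⟩
      exact hs j
    · simp only [columns, List.mem_map, List.mem_range]
      rintro _ ⟨j, hj, rfl⟩
      have := zero_lt j hj
      simp; omega
    · rw [List.isChain_iff_getElem]
      intro j hj
      simp only [columns, List.getElem_map, List.getElem_range]
      rw [rowLE_iff_getD (hs _) (hs _)]
      simp only [List.length_map, List.length_range]
      have hle := lam.colLen_anti j (j + 1) (by omega)
      refine ⟨hle, fun i hi => ?_⟩
      rw [List.getD_eq_getElem _ _ (by simpa using hi.trans_le hle),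
        List.getD_eq_getElem _ _ (by simpa using hi)]
      simpa using T.row_weak (Nat.lt_succ_self j) (YoungDiagram.mem_iff_lt_colLen.2 hi)
    · simp [columns, Function.comp_def]
    · simp only [columns, List.mem_flatten, List.mem_map]
      rintro a ⟨_, ⟨j, -, rfl⟩, ha⟩
      obtain ⟨i, hi, rfl⟩ := List.mem_map.1 ha
      exact hT i j (YoungDiagram.mem_iff_lt_colLen.2 (List.mem_range.1 hi))
  · rintro ⟨hC, hlen, hp⟩
    have hl : C.length = lam.rowLen 0 := by simpa using congrArg List.length hlen
    have hcol : ∀ j (hj : j < C.length), C[j].length = lam.colLen j := by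
      intro j hj
      have : (C.map List.length)[j]'(by simpa using hj) = lam.colLen j := by
        simp only [hlen, List.getElem_map, List.getElem_range]
      simpa using this
    have hmem : ∀ i j, (i, j) ∈ lam → ∃ hj : j < C.length, i < C[j].length := by
      intro i j hij
      have hj : j < C.length := by
        rw [hl, ← YoungDiagram.mem_iff_lt_rowLen]
        exact lam.up_left_mem (Nat.zero_le i) le_rfl hij
      exact ⟨hj, by rwa [hcol j hj, ← YoungDiagram.mem_iff_lt_colLen]⟩
    have hpw := List.pairwise_iff_getElem.1 (List.isChain_iff_pairwise.1 hC.chain)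
    refine ⟨⟨fun i j => (C.getD j []).getD i 0, ?_, ?_, ?_⟩, ?_, ?_⟩
    · intro i j₁ j₂ hj hij
      obtain ⟨hj₂, hi⟩ := hmem i j₂ hij
      rw [List.getD_eq_getElem C [] hj₂, List.getD_eq_getElem C [] (hj.trans hj₂)]
      exact ((rowLE_iff_getD (hC.sorted _ (List.getElem_mem _))
        (hC.sorted _ (List.getElem_mem _))).1 (hpw j₁ j₂ (hj.trans hj₂) hj₂ hj)).2 i hi
    · intro i₁ i₂ j hi hij
      obtain ⟨hj, hi₂⟩ := hmem i₂ j hij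
      rw [List.getD_eq_getElem C [] hj, List.getD_eq_getElem _ _ hi₂,
        List.getD_eq_getElem _ _ (hi.trans hi₂)]
      exact List.pairwise_iff_getElem.1 (hC.sorted _ (List.getElem_mem hj)) _ _ _ _ hi
    · intro i j hij
      by_cases hj : j < C.length
      · rw [List.getD_eq_getElem C [] hj]
        refine List.getD_eq_default _ _ ?_
        rw [hcol j hj]
        rwa [YoungDiagram.mem_iff_lt_colLen, not_lt] at hij
      · rw [List.getD_eq_default C [] (by omega)]
        rfl
    · intro i j hij
      obtain ⟨hj, hi⟩ := hmem i j hij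
      change p ((C.getD j []).getD i 0)
      rw [List.getD_eq_getElem C [] hj, List.getD_eq_getElem _ _ hi]
      exact hp _ (List.mem_flatten.2 ⟨_, List.getElem_mem hj, List.getElem_mem hi⟩)
    · refine List.ext_getElem (by simp [columns, hl]) fun j hj _ => ?_
      refine List.ext_getElem (by simp [columns, hcol]) fun i hi _ => ?_
      simp only [columns, List.getElem_map, List.getElem_range]
      change _ = (C.getD j []).getD i 0
      rw [List.getD_eq_getElem C [] hj, List.getD_eq_getElem _ _ hi]

/-! ### The shape of the tableau of a nonwrapping multiline queue -/

theorem Dominated.perm_right {Q P P' : List ℕ} (h : Dominated Q P) (hp : P.Perm P') :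
    Dominated Q P' := fun t => by
  rw [← hp.countP_eq]
  exact h t

theorem Dominated.cons {q p : ℕ} {Q P : List ℕ} (h : Dominated Q P) (hqp : q ≤ p) :
    Dominated (q :: Q) (p :: P) := fun t => by
  have := h t
  simp only [List.countP_cons, decide_eq_true_eq]
  split_ifs <;> omega

theorem Dominated.exists_le {q : ℕ} {Q P : List ℕ} (h : Dominated (q :: Q) P) :
    ∃ p ∈ P, q ≤ p := by
  have h1 := h q
  have h2 : 0 < P.countP (fun a => decide (q ≤ a)) := by
    simp at h1
    omega
  simpa using List.countP_pos_iff.1 h2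

/-- Greedy choices are safe. Only thresholds `q < t ≤ c` could fail, and there `P` has the same
count as at `q`, where the hypothesis has one unit to spare for `Q`. -/
theorem Dominated.erase {q c : ℕ} {Q P : List ℕ} (h : Dominated (q :: Q) P) (hc : c ∈ P)
    (hmin : ∀ a ∈ P, q ≤ a → c ≤ a) : Dominated Q (P.erase c) := by
  intro t
  have hp := fun t => (List.perm_cons_erase hc).countP_eq (fun a => decide (t ≤ a))
  have h1 := h t
  have h2 := h q
  have h3 := hp t
  simp only [List.countP_cons, decide_eq_true_eq, le_refl, if_true] at h1 h2 h3
  by_cases ht : q < t ∧ t ≤ c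
  · have h4 : P.countP (fun a => decide (q ≤ a)) = P.countP (fun a => decide (t ≤ a)) :=
      List.countP_congr fun a ha => by
        have := hmin a ha
        simp only [decide_eq_true_eq]
        omega
    have h5 : Q.countP (fun a => decide (t ≤ a)) ≤ Q.countP (fun a => decide (q ≤ a)) :=
      List.countP_mono_left fun a _ => by
        simp only [decide_eq_true_eq]
        omega
    split_ifs at h1 h3 <;> omega
  · split_ifs at h1 h3 <;> omega

theorem bumpColumn_perm_erase {x y : ℕ} {C : List ℕ} (hC : C.Pairwise (· < ·))
    (h : (bumpColumn x C).2 = some y) : (bumpColumn x C).1.Perm (x :: C.erase y) := by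
  have h1 := bumpColumn_perm x C
  rw [h] at h1
  have h2 := (List.perm_cons_erase (bumpColumn_some hC h).2.1).cons x
  refine List.Perm.cons_inv (a := y) ?_
  exact (List.perm_append_comm (l₁ := [y])).trans (h1.trans (h2.trans (.swap _ _ _)))

theorem mem_bumpWord_of_forall_lt {a : ℕ} {C w : List ℕ} (hC : C.Pairwise (· < ·)) (ha : a ∈ C)
    (hw : ∀ x ∈ w, a < x) : a ∈ (bumpWord C w).1 := by
  induction w generalizing C with
  | nil => exact ha
  | cons x w ih =>
    refine ih (bumpColumn_sorted hC) ?_ fun y hy => hw y (by simp [hy])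
    have := (bumpColumn_perm x C).symm.subset (List.mem_cons_of_mem _ ha)
    rcases List.mem_append.1 this with h | h
    · exact h
    · rw [Option.mem_toList] at h
      have h1 := (bumpColumn_some hC h).1
      have h2 := hw x (by simp)
      omega

theorem mem_of_mem_bumpWord {C w : List ℕ} (hC : C.Pairwise (· < ·)) (hw : w.Pairwise (· < ·))
    {y : ℕ} (hy : y ∈ (bumpWord C w).2) : y ∈ C ∧ ∃ x ∈ w, x ≤ y := by
  induction w generalizing C with
  | nil => simp [bumpWord] at hy
  | cons x w ih =>
    rw [List.pairwise_cons] at hw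
    rw [bumpWord, List.mem_append, Option.mem_toList] at hy
    rcases hy with hy | hy
    · obtain ⟨h1, h2, -⟩ := bumpColumn_some hC hy
      exact ⟨h2, x, by simp, h1⟩
    · obtain ⟨h1, x', hx', h2⟩ := ih (bumpColumn_sorted hC) hw.2 hy
      have := hw.1 x' hx'
      exact ⟨(mem_bumpColumn h1).resolve_left (by omega), x', by simp [hx'], h2⟩

theorem Dominated.bumpColumn_eq_some {q : ℕ} {Q C : List ℕ} (h : Dominated (q :: Q) C) :
    ∃ c, (bumpColumn q C).2 = some c := by
  rcases hb : (bumpColumn q C).2 with _ | c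
  · obtain ⟨p, hp, hqp⟩ := h.exists_le
    have := lt_of_bumpColumn_none hb p hp
    omega
  · exact ⟨c, rfl⟩

/-- Bumping performs the greedy matching of `Q` into `C`, so the bumped word is the least increasing
word from `C` that dominates `Q`. This minimality, the last clause, is what later keeps the bumped
words in a chain. -/
theorem bumpWord_spec_of_dominated {C Q : List ℕ} (hC : C.Pairwise (· < ·))
    (hQ : Q.Pairwise (· < ·)) (h : Dominated Q C) :
    (bumpWord C Q).2.Pairwise (· < ·) ∧ (bumpWord C Q).2.length = Q.length ∧
      (bumpWord C Q).1.length = C.length ∧ (∀ q ∈ Q, q ∈ (bumpWord C Q).1) ∧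
      Dominated Q (bumpWord C Q).2 ∧
      ∀ D : List ℕ, D.Pairwise (· < ·) → (∀ d ∈ D, d ∈ C) → Dominated Q D →
        Dominated (bumpWord C Q).2 D := by
  induction Q generalizing C with
  | nil => simp [bumpWord, Dominated]
  | cons q Q ih =>
    obtain ⟨c, hc⟩ := h.bumpColumn_eq_some
    obtain ⟨hqc, hcC, hmin⟩ := bumpColumn_some hC hc
    have hp := bumpColumn_perm_erase hC hc
    have hs := bumpColumn_sorted (x := q) hC
    have hQ' := List.pairwise_cons.1 hQ
    have hnd : C.Nodup := hC.imp fun h => h.ne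
    obtain ⟨i1, i2, i3, i4, i5, i6⟩ := ih hs hQ'.2
      (((h.erase hcC hmin).append_right [q]).perm_right
        (List.perm_append_comm.trans hp.symm))
    simp only [bumpWord, hc, Option.toList_some, List.singleton_append]
    refine ⟨List.pairwise_cons.2 ⟨fun y hy => ?_, i1⟩, by simp [i2], ?_, ?_, i5.cons hqc, ?_⟩
    · obtain ⟨hy1, x, hx, hxy⟩ := mem_of_mem_bumpWord hs hQ'.2 hy
      have hqx := hQ'.1 x hx
      have hy2 := hp.subset hy1
      rw [List.mem_cons, hnd.mem_erase_iff] at hy2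
      obtain ⟨hy3, hy4⟩ := hy2.resolve_left (by omega)
      exact lt_of_le_of_ne (hmin y hy4 (by omega)) (Ne.symm hy3)
    · rw [i3, hp.length_eq, ← (List.perm_cons_erase hcC).length_eq.symm.trans rfl]
      rfl
    · intro a ha
      rcases List.mem_cons.1 ha with rfl | ha
      · exact mem_bumpWord_of_forall_lt hs (self_mem_bumpColumn _ _) hQ'.1
      · exact i4 a ha
    · intro D hD hDC hqD
      obtain ⟨d, hd⟩ := hqD.bumpColumn_eq_some
      obtain ⟨hqd, hdD, hdmin⟩ := bumpColumn_some hD hd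
      have hDnd : D.Nodup := hD.imp fun h => h.ne
      have := i6 (D.erase d) (hD.sublist List.erase_sublist) (fun a ha => ?_)
        (hqD.erase hdD hdmin)
      · exact (this.cons (hmin d (hDC d hdD) hqd)).perm_right (List.perm_cons_erase hdD).symm
      · rw [hDnd.mem_erase_iff] at ha
        refine hp.symm.subset (List.mem_cons_of_mem _ (hnd.mem_erase_iff.2 ⟨?_, hDC a ha.2⟩))
        -- If `c` lies in `D`, minimality in `C` and in `D` forces `d = c`, which has been erased.
        rintro rfl
        exact ha.1 (le_antisymm (hmin d (hDC d hdD) hqd) (hdmin a ha.2 hqc))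

theorem bumpWord_append (C v w : List ℕ) :
    bumpWord C (v ++ w) = ((bumpWord (bumpWord C v).1 w).1,
      (bumpWord C v).2 ++ (bumpWord (bumpWord C v).1 w).2) := by
  induction v generalizing C with
  | nil => rfl
  | cons x v ih => simp [bumpWord, ih]

/-- The bumped words interlace with the inserted ones: each is dominated by the preceding inserted
word, by minimality since that word still lies in the column, and that word is dominated by what it
bumped out itself. -/
theorem bumpWord_flatten {C W : List ℕ} {Ws : List (List ℕ)} (hC : C.Pairwise (· < ·))
    (hW : W.Pairwise (· < ·)) (hWC : ∀ a ∈ W, a ∈ C) (hWs : ∀ V ∈ Ws, V.Pairwise (· < ·))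
    (h : (W :: Ws).IsChain fun P Q => Dominated Q P) :
    (bumpWord C Ws.flatten).1.length = C.length ∧
      ∃ Xs : List (List ℕ), (bumpWord C Ws.flatten).2 = Xs.flatten ∧
        Xs.map List.length = Ws.map List.length ∧ (∀ X ∈ Xs, X.Pairwise (· < ·)) ∧
        ∀ V, Dominated W V → (V :: Xs).IsChain fun P Q => Dominated Q P := by
  induction Ws generalizing C W with
  | nil => exact ⟨rfl, [], rfl, rfl, by simp, fun V _ => List.isChain_singleton V⟩
  | cons Q Ws ih =>
    rw [List.isChain_cons_cons] at h
    have hQ := hWs Q (by simp)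
    have hQC : Dominated Q C := fun t => (h.1 t).trans
      ((List.subperm_of_subset (hW.imp fun h => h.ne) hWC).countP_le _)
    obtain ⟨h1, h2, h3, h4, h5, h6⟩ := bumpWord_spec_of_dominated hC hQ hQC
    obtain ⟨i1, Xs, i2, i3, i4, i5⟩ := ih (bumpWord_sorted hC Q) hQ h4
      (fun V hV => hWs V (by simp [hV])) h.2
    rw [List.flatten_cons, bumpWord_append]
    refine ⟨i1.trans h3, (bumpWord C Q).2 :: Xs, by simp [i2], by simp [i3, h2],
      List.forall_mem_cons.2 ⟨h1, i4⟩, fun V hV => List.isChain_cons_cons.2 ⟨?_, i5 _ h5⟩⟩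
    exact (h6 W hW hWC h.1).trans hV

theorem map_length_Icol_flatten {Ws : List (List ℕ)} (hWs : ∀ V ∈ Ws, V.Pairwise (· < ·))
    (hne : ∀ V ∈ Ws, V ≠ []) (h : Ws.IsChain fun P Q => Dominated Q P) :
    (Icol Ws.flatten).map List.length = Ws.map List.length := by
  obtain ⟨n, hn⟩ : ∃ n, Ws.length = n := ⟨_, rfl⟩
  induction n generalizing Ws with
  | zero =>
    rw [List.length_eq_zero_iff] at hn
    subst hn
    rfl
  | succ n ih =>
    obtain ⟨W, Ws, rfl⟩ := List.exists_cons_of_length_eq_add_one hn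
    have hW := hWs W (by simp)
    obtain ⟨h1, Xs, h2, h3, h4, h5⟩ := bumpWord_flatten hW hW (fun _ h => h)
      (fun V hV => hWs V (by simp [hV])) h
    have hlen : Xs.length = Ws.length := by simpa using congrArg List.length h3
    have hIcol : Icol W = [W] := (isTableau_cons (T := []).2
      ⟨hW, hne W (by simp), rowLE_nil W, .nil⟩).insertWord_column
    have hXne : ∀ X ∈ Xs, X ≠ [] := by
      intro X hX
      have : X.length ∈ Ws.map List.length := h3 ▸ List.mem_map_of_mem hX
      obtain ⟨V, hV, hVX⟩ := List.mem_map.1 this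
      have := hne V (by simp [hV])
      rwa [← List.length_pos_iff, ← hVX, List.length_pos_iff]
    have := ih h4 hXne (h5 W fun t => le_rfl).tail (by simp at hn; omega)
    rw [List.flatten_cons, Icol_append, hIcol, insertWord_cons, h2, List.map_cons, List.map_cons,
      h1, ← h3, ← this]
    rfl

theorem rw_eq_flatten (M : List (Finset ℕ)) :
    rw M = (M.map fun B => B.sort (· ≤ ·)).flatten := List.flatMap_def ..

theorem Nonwrapping.map_length_tab {M : List (Finset ℕ)} (h : Nonwrapping M) :
    (tab M).map List.length = M.map Finset.card := by
  rw [tab, rw_eq_flatten, map_length_Icol_flatten]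
  · simp [Function.comp_def]
  · simp only [List.mem_map]
    rintro _ ⟨B, -, rfl⟩
    exact sort_pairwise B
  · simp only [List.mem_map]
    rintro _ ⟨B, hB, rfl⟩ h0
    have := h.nonempty B hB
    rw [← List.length_eq_zero_iff, Finset.length_sort, Finset.card_eq_zero] at h0
    exact this h0
  · rw [List.isChain_map]
    exact h.chain.imp fun _ _ => dominated_sort_iff.2

/-! ### Injectivity -/

/-- Reverse bumping: the inserted letter is the largest entry `≤ y` of the new column. In the mixed
cases the other inserted letter would sit above the bottom entry, yet not exceed `y`. -/
theorem bumpColumn_injective {x x' y : ℕ} {C C' : List ℕ} (hC : C.Pairwise (· < ·))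
    (hC' : C'.Pairwise (· < ·)) (h : (bumpColumn x C).2 = some y)
    (h' : (bumpColumn x' C').2 = some y) (he : (bumpColumn x C).1 = (bumpColumn x' C').1) :
    x = x' ∧ C = C' := by
  induction C generalizing C' with
  | nil => simp [bumpColumn] at h
  | cons c C ih =>
    cases C' with
    | nil => simp [bumpColumn] at h'
    | cons c' C' =>
      rw [List.pairwise_cons] at hC hC'
      rw [bumpColumn] at h h' he
      rw [bumpColumn] at he
      split_ifs at h h' he with h1 h2 h2
      · simp at h h' he
        simp [he, h, h']
      · simp only [List.cons.injEq, Option.some.injEq] at h he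
        have h3 := hC.1 x' (he.2 ▸ self_mem_bumpColumn x' C')
        have h4 := (bumpColumn_some hC'.2 h').1
        omega
      · simp only [List.cons.injEq, Option.some.injEq] at h' he
        have h3 := hC'.1 x (he.2 ▸ self_mem_bumpColumn x C)
        have h4 := (bumpColumn_some hC.2 h).1
        omega
      · simp only [List.cons.injEq] at he
        obtain ⟨h3, h4⟩ := ih hC.2 hC'.2 h h' he.2
        exact ⟨h3, by rw [he.1, h4]⟩

theorem length_bumpColumn (x : ℕ) (C : List ℕ) :
    (bumpColumn x C).1.length + (bumpColumn x C).2.toList.length = C.length + 1 := by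
  simpa using (bumpColumn_perm x C).length_eq

/-- Equal shapes before and after insertion force both insertions to stop in the same column; from
there the bumps are undone one by one. -/
theorem insertTab_injective {k k' : ℕ} {T T' : List (List ℕ)}
    (hT : ∀ C ∈ T, C.Pairwise (· < ·)) (hT' : ∀ C ∈ T', C.Pairwise (· < ·))
    (hlen : T.map List.length = T'.map List.length) (h : insertTab k T = insertTab k' T') :
    k = k' ∧ T = T' := by
  induction T generalizing T' k k' with
  | nil =>
    obtain rfl : T' = [] := by simpa using hlen.symm
    simpa [insertTab] using h
  | cons C T ih =>
    cases T' with
    | nil => simp at hlen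
    | cons C' T' =>
      simp only [List.map_cons, List.cons.injEq] at hlen
      have hC := hT C (by simp)
      have hC' := hT' C' (by simp)
      have l1 := length_bumpColumn k C
      have l2 := length_bumpColumn k' C'
      have inj := fun y => bumpColumn_injective (x := k) (x' := k') (y := y) hC hC'
      have n1 := fun h => bumpColumn_of_forall_lt (lt_of_bumpColumn_none (x := k) (C := C) h)
      have n2 := fun h => bumpColumn_of_forall_lt (lt_of_bumpColumn_none (x := k') (C := C') h)
      rw [insertTab, insertTab] at h
      rcases hb : bumpColumn k C with ⟨D, _ | y⟩ <;>
        rcases hb' : bumpColumn k' C' with ⟨D', _ | y'⟩ <;>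
        simp only [hb, hb', List.cons.injEq, Option.toList_some, Option.toList_none,
          List.length_nil, List.length_singleton] at h l1 l2 inj n1 n2
      · obtain ⟨rfl, rfl⟩ := h
        have e1 := n1 trivial
        have e2 := n2 trivial
        simp only [Prod.mk.injEq, and_true] at e1 e2
        rw [e1] at e2
        obtain ⟨e3, e4⟩ := List.append_inj' e2 rfl
        simp at e4
        exact ⟨e4, by rw [e3]⟩
      · have := congrArg List.length h.1
        omega
      · have := congrArg List.length h.1
        omega
      · obtain ⟨rfl, h⟩ := h
        obtain ⟨rfl, rfl⟩ := ih (fun D hD => hT D (by simp [hD]))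
          (fun D hD => hT' D (by simp [hD])) hlen.2 h
        obtain ⟨h3, rfl⟩ := inj y rfl rfl rfl
        exact ⟨h3, rfl⟩

theorem Nonwrapping.exists_remove {M : List (Finset ℕ)} {B : Finset ℕ}
    (h : Nonwrapping (M ++ [B])) : ∃ k ∈ B, RowChain (M ++ [B.erase k]) ∧
      tab (M ++ [B]) = insertTab k (tab (M ++ [B.erase k])) := by
  have hB : B.Nonempty := Finset.nonempty_iff_ne_empty.2 (h.nonempty B (by simp))
  refine ⟨B.max' hB, B.max'_mem hB, ?_, ?_⟩
  · refine List.isChain_append.2 ⟨h.chain.left_of_append, List.isChain_singleton _, ?_⟩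
    intro A hA D hD
    have h1 := (List.isChain_append.1 h.chain).2.2 A hA B (by simp)
    obtain rfl : B.erase (B.max' hB) = D := by simpa using hD
    exact RowDominated.trans (fun t => Finset.card_le_card
      (Finset.filter_subset_filter _ (Finset.erase_subset _ _))) h1
  · have : B.sort (· ≤ ·) = (B.erase (B.max' hB)).sort (· ≤ ·) ++ [B.max' hB] := by
      refine sort_eq_of_sorted (List.pairwise_append.2 ⟨sort_pairwise _, by simp, ?_⟩) fun a => ?_
      · intro a ha b hb
        rw [Finset.mem_sort, Finset.mem_erase] at ha
        rw [List.mem_singleton] at hb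
        exact hb ▸ lt_of_le_of_ne (B.le_max' a ha.2) ha.1
      · have := B.max'_mem hB
        simp only [List.mem_append, Finset.mem_sort, Finset.mem_erase, List.mem_singleton]
        grind
    have e : rw (M ++ [B]) = rw (M ++ [B.erase (B.max' hB)]) ++ [B.max' hB] := by
      simp [this, rw]
    rw [tab, e, Icol_append]
    rfl

theorem tab_injective {M M' : List (Finset ℕ)} (h : Nonwrapping M) (h' : Nonwrapping M')
    (he : tab M = tab M') : M = M' := by
  obtain ⟨n, hn⟩ : ∃ n, (M.map Finset.card).sum = n := ⟨_, rfl⟩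
  induction n using Nat.strong_induction_on generalizing M M' with
  | h n ih =>
  have hcard : M.map Finset.card = M'.map Finset.card := by
    rw [← h.map_length_tab, ← h'.map_length_tab, he]
  rcases List.eq_nil_or_concat' M with rfl | ⟨M, B, rfl⟩
  · simpa using hcard.symm
  rcases List.eq_nil_or_concat' M' with rfl | ⟨M', B', rfl⟩
  · simp at hcard
  rw [List.map_append, List.map_append] at hcard
  obtain ⟨hc1, hc2⟩ := List.append_inj' hcard rfl
  simp only [List.map_cons, List.map_nil, List.cons.injEq, and_true] at hc2
  obtain ⟨k, hk, hch, ht⟩ := h.exists_remove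
  obtain ⟨k', hk', hch', ht'⟩ := h'.exists_remove
  have hce := Finset.card_erase_add_one hk
  have hce' := Finset.card_erase_add_one hk'
  have finish : ∀ N N' : List (Finset ℕ), Nonwrapping N → Nonwrapping N' →
      tab (M ++ [B.erase k]) = tab N → tab (M' ++ [B'.erase k']) = tab N' →
      N.map Finset.card = N'.map Finset.card → (N.map Finset.card).sum < n → k = k' ∧ N = N' := by
    intro N N' hN hN' e1 e2 e3 e4
    obtain ⟨h1, h2⟩ := insertTab_injective (isTableau_Icol _).sorted (isTableau_Icol _).sorted
      (show (tab N).map List.length = (tab N').map List.length by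
        rw [hN.map_length_tab, hN'.map_length_tab, e3])
      (show insertTab k (tab N) = insertTab k' (tab N') by rw [← e1, ← e2, ← ht, ← ht', he])
    exact ⟨h1, ih _ e4 hN hN' h2 rfl⟩
  simp only [List.map_append, List.map_cons, List.map_nil, List.sum_append, List.sum_singleton]
    at hn
  have tab_empty : ∀ N : List (Finset ℕ), tab (N ++ [∅]) = tab N := fun N => by
    simp [tab, rw]
  -- A top row emptied by the removal must be discarded before induction, since `Nonwrapping`
  -- forbids empty rows.
  by_cases hB : B.erase k = ∅
  · have hB' : B'.erase k' = ∅ := by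
      rw [← Finset.card_eq_zero] at hB ⊢
      omega
    obtain ⟨rfl, rfl⟩ := finish M M' ⟨h.chain.left_of_append, fun D hD => h.nonempty D (by simp [hD])⟩
      ⟨h'.chain.left_of_append, fun D hD => h'.nonempty D (by simp [hD])⟩
      (by rw [hB, tab_empty]) (by rw [hB', tab_empty]) hc1 (by omega)
    rw [← Finset.insert_erase hk, ← Finset.insert_erase hk', hB, hB']
  · have hB' : B'.erase k' ≠ ∅ := by
      rw [ne_eq, ← Finset.card_eq_zero]
      rw [← Finset.card_eq_zero] at hB
      omega
    obtain ⟨rfl, h2⟩ := finish _ _ (hch.nonwrapping hB) (hch'.nonwrapping hB') rfl rfl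
      (by rw [List.map_append, List.map_append, hc1]; simp; omega)
      (by simp; omega)
    obtain ⟨rfl, h3⟩ := List.append_inj' h2 rfl
    simp only [List.cons.injEq, and_true] at h3
    rw [← Finset.insert_erase hk, ← Finset.insert_erase hk', h3]

/-! ### Ferrari–Martin pairings -/

theorem firstWeaklyRight_spec {U : Finset ℕ} {c u : ℕ} (hu : u ∈ U) (hcu : c ≤ u) :
    firstWeaklyRight U c ∈ U ∧ c ≤ firstWeaklyRight U c ∧
      ∀ a ∈ U, c ≤ a → firstWeaklyRight U c ≤ a := by
  have h : (U.filter (c ≤ ·)).Nonempty := ⟨u, by simp [hu, hcu]⟩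
  rw [firstWeaklyRight, dif_pos h]
  have := Finset.mem_filter.1 ((U.filter (c ≤ ·)).min'_mem h)
  exact ⟨this.1, this.2, fun a ha hca => Finset.min'_le _ _ (by simp [ha, hca])⟩

theorem sort_erase_perm (U : Finset ℕ) (c : ℕ) :
    ((U.sort (· ≤ ·)).erase c).Perm ((U.erase c).sort (· ≤ ·)) := by
  rw [← Multiset.coe_eq_coe, Finset.sort_eq, ← Multiset.coe_erase, Finset.sort_eq,
    Finset.erase_val]

/-- Hall's condition for the greedy pairing. The right-hand side depends only on the multiset of
columns, so the priority order is irrelevant. -/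
theorem pairBalls_wraps_iff (r : ℕ) (bs : List (ℕ × ℕ)) (U : Finset ℕ) :
    (∀ p ∈ pairBalls r bs U, p.wraps = false) ↔
      Dominated (bs.map Prod.snd) (U.sort (· ≤ ·)) := by
  induction bs generalizing U with
  | nil => simp [pairBalls, Dominated]
  | cons b bs ih =>
    rw [pairBalls, List.forall_mem_cons, ih, List.map_cons]
    have hw : (decide (∀ u ∈ U, u < b.2) = false) ↔ ∃ u ∈ U, b.2 ≤ u := by simp
    rw [hw]
    constructor
    · rintro ⟨⟨u, hu, hbu⟩, h⟩
      obtain ⟨h1, h2, -⟩ := firstWeaklyRight_spec hu hbu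
      exact ((h.perm_right (sort_erase_perm _ _).symm).cons h2).perm_right
        (List.perm_cons_erase (by simpa using h1)).symm
    · intro h
      obtain ⟨u, hu, hbu⟩ := h.exists_le
      rw [Finset.mem_sort] at hu
      obtain ⟨h1, -, h3⟩ := firstWeaklyRight_spec hu hbu
      exact ⟨⟨u, hu, hbu⟩, (h.erase (by simpa using h1) (by simpa using h3)).perm_right
        (sort_erase_perm _ _)⟩

theorem pairBalls_targets {r : ℕ} {bs : List (ℕ × ℕ)} {U : Finset ℕ}
    (h : ∀ p ∈ pairBalls r bs U, p.wraps = false) :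
    ((pairBalls r bs U).map Pairing.target).Nodup ∧
      ∀ a ∈ (pairBalls r bs U).map Pairing.target, a ∈ U := by
  induction bs generalizing U with
  | nil => simp [pairBalls]
  | cons b bs ih =>
    rw [pairBalls, List.forall_mem_cons] at h
    obtain ⟨⟨u, hu, hbu⟩, h⟩ : (∃ u ∈ U, b.2 ≤ u) ∧ _ := by simpa using h
    obtain ⟨h1, -, -⟩ := firstWeaklyRight_spec hu hbu
    obtain ⟨i1, i2⟩ := ih (by simpa using h)
    rw [pairBalls, List.map_cons]
    refine ⟨List.nodup_cons.2 ⟨fun hmem => ?_, i1⟩, List.forall_mem_cons.2 ⟨h1, fun a ha => ?_⟩⟩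
    · simpa using i2 _ hmem
    · exact Finset.mem_of_mem_erase (i2 a ha)

/-- The second clause feeds the induction: as long as nothing wraps, the labelled balls handed down
are exactly the balls of the row, each once. -/
theorem fm_wraps_iff (r : ℕ) (M : List (Finset ℕ)) :
    ((∀ p ∈ (fm r M).2, p.wraps = false) ↔ RowChain M) ∧
      ((∀ p ∈ (fm r M).2, p.wraps = false) →
        ((fm r M).1.map Prod.snd).Perm ((M.headD ∅).sort (· ≤ ·))) := by
  induction M generalizing r with
  | nil => simp [fm, RowChain]
  | cons B M ih =>
    obtain ⟨ih1, ih2⟩ := ih (r + 1)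
    have hpr : ((priorityOrder (fm (r + 1) M).1).map Prod.snd).Perm
        ((fm (r + 1) M).1.map Prod.snd) := (List.mergeSort_perm _ _).map _
    have hchain : RowChain (B :: M) ↔ RowDominated (M.headD ∅) B ∧ RowChain M := by
      cases M with
      | nil => simp [RowChain, rowDominated_empty]
      | cons A M => exact List.isChain_cons_cons
    simp only [fm, List.forall_mem_append, pairBalls_wraps_iff, ih1, hchain]
    refine ⟨and_congr_left fun hM => ?_, fun ⟨h1, h2⟩ => ?_⟩
    · rw [← dominated_sort_iff]
      have hp := hpr.trans (ih2 (ih1.2 hM))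
      exact forall_congr' fun t => by rw [hp.countP_eq]
    · obtain ⟨h3, h4⟩ := pairBalls_targets ((pairBalls_wraps_iff (r + 1) _ _).2 h1)
      generalize pairBalls (r + 1) (priorityOrder (fm (r + 1) M).1) B = ps at h3 h4
      simp only [List.map_append, List.map_map, List.headD_cons, Function.comp_def, List.map_id']
      change (ps.map Pairing.target ++ _).Perm _
      rw [List.perm_ext_iff_of_nodup]
      · intro a
        simp only [List.mem_append, Finset.mem_sort, Finset.mem_sdiff, List.mem_toFinset]
        have := h4 a
        tauto
      · refine List.nodup_append'.2 ⟨h3, Finset.sort_nodup _ _, fun a ha ha' => ?_⟩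
        simp only [Finset.mem_sort, Finset.mem_sdiff, List.mem_toFinset] at ha'
        exact ha'.2 ha
      · exact Finset.sort_nodup _ _

/-- A wrapping pairing contributes at least `1` whatever its label, because of the final `+ 1` after
the truncated subtraction. -/
theorem maj_eq_zero_iff (M : List (Finset ℕ)) : maj M = 0 ↔ RowChain M := by
  rw [← (fm_wraps_iff 1 M).1, maj, List.sum_eq_zero_iff]
  simp

theorem mem_MLQ₀Bounded_iff {lam : YoungDiagram} {n : ℕ} {M : List (Finset ℕ)} :
    M ∈ MLQ₀Bounded lam n ↔ Nonwrapping M ∧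
      M.map Finset.card = (List.range (lam.rowLen 0)).map lam.colLen ∧
        ∀ a ∈ rw M, 0 < a ∧ a ≤ n := by
  have mem_rw : ∀ a, a ∈ rw M ↔ ∃ B ∈ M, a ∈ B := fun a => by simp [rw]
  constructor
  · rintro ⟨⟨hlen, h⟩, hmaj⟩
    have hget : ∀ j (hj : j < M.length), M[j] ⊆ Finset.Icc 1 n ∧ M[j].card = lam.colLen j := by
      intro j hj
      have := h j (hlen ▸ hj)
      rwa [List.getD_eq_getElem _ _ hj] at this
    refine ⟨⟨(maj_eq_zero_iff M).1 hmaj, fun B hB => ?_⟩, ?_, fun a ha => ?_⟩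
    · obtain ⟨j, hj, rfl⟩ := List.getElem_of_mem hB
      have : 0 < lam.colLen j := YoungDiagram.mem_iff_lt_colLen.1
        (YoungDiagram.mem_iff_lt_rowLen.2 (hlen ▸ hj))
      rw [← (hget j hj).2, Finset.card_pos] at this
      exact this.ne_empty
    · refine List.ext_getElem (by simp [hlen]) fun j hj _ => ?_
      simpa using (hget j (by simpa using hj)).2
    · obtain ⟨B, hB, haB⟩ := (mem_rw a).1 ha
      obtain ⟨j, hj, rfl⟩ := List.getElem_of_mem hB
      have := Finset.mem_Icc.1 ((hget j hj).1 haB)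
      exact ⟨this.1, this.2⟩
  · rintro ⟨hM, hcard, h⟩
    have hlen : M.length = lam.rowLen 0 := by simpa using congrArg List.length hcard
    refine ⟨⟨hlen, fun j hj => ?_⟩, (maj_eq_zero_iff M).2 hM.chain⟩
    rw [← hlen] at hj
    rw [List.getD_eq_getElem _ _ hj]
    refine ⟨fun a ha => Finset.mem_Icc.2 (h a ((mem_rw a).2 ⟨_, List.getElem_mem hj, ha⟩)), ?_⟩
    have : (M.map Finset.card)[j]'(by simpa using hj) = lam.colLen j := by
      simp only [hcard, List.getElem_map, List.getElem_range]
    simpa using this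

theorem mem_MLQ₀_iff {lam : YoungDiagram} {M : List (Finset ℕ)} :
    M ∈ MLQ₀ lam ↔ Nonwrapping M ∧
      M.map Finset.card = (List.range (lam.rowLen 0)).map lam.colLen ∧ ∀ a ∈ rw M, 0 < a := by
  simp only [MLQ₀, Set.mem_iUnion, mem_MLQ₀Bounded_iff]
  constructor
  · rintro ⟨n, h1, h2, h3⟩
    exact ⟨h1, h2, fun a ha => (h3 a ha).1⟩
  · rintro ⟨h1, h2, h3⟩
    exact ⟨(rw M).sum, h1, h2, fun a ha => ⟨h3 a ha, List.single_le_sum (by simp) a ha⟩⟩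

/-! ### The correspondence -/

theorem tab_mlq {T : List (List ℕ)} (h : IsTableau T) : tab (mlq T) = T := by
  rw [mlq, (rho_spec _).2, h.Icol_revcrw]

theorem nonwrapping_mlq (T : List (List ℕ)) : Nonwrapping (mlq T) := (rho_spec _).1

theorem mlq_tab {M : List (Finset ℕ)} (h : Nonwrapping M) : mlq (tab M) = M :=
  tab_injective (nonwrapping_mlq _) h (tab_mlq (isTableau_Icol _))

/-- Semistandard tableaux with the column lengths `s` and with entries satisfying `p`. -/
def tableauxOf (s : List ℕ) (p : ℕ → Prop) : Set (List (List ℕ)) :=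
  {T | IsTableau T ∧ T.map List.length = s ∧ ∀ a ∈ T.flatten, p a}

/-- Nonwrapping multiline queues with the row sizes `s` and with balls in columns satisfying `p`. -/
def queuesOf (s : List ℕ) (p : ℕ → Prop) : Set (List (Finset ℕ)) :=
  {M | Nonwrapping M ∧ M.map Finset.card = s ∧ ∀ a ∈ rw M, p a}

theorem invOn_tab_mlq (s : List ℕ) (p : ℕ → Prop) :
    Set.InvOn tab mlq (tableauxOf s p) (queuesOf s p) :=
  ⟨fun _ hT => tab_mlq hT.1, fun _ hM => mlq_tab hM.1⟩

theorem mapsTo_tab (s : List ℕ) (p : ℕ → Prop) :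
    Set.MapsTo tab (queuesOf s p) (tableauxOf s p) := by
  rintro M ⟨h1, h2, h3⟩
  exact ⟨isTableau_Icol _, by rw [h1.map_length_tab, h2],
    fun a ha => h3 a ((Icol_flatten_perm _).subset ha)⟩

theorem mapsTo_mlq (s : List ℕ) (p : ℕ → Prop) :
    Set.MapsTo mlq (tableauxOf s p) (queuesOf s p) := by
  rintro T ⟨h1, h2, h3⟩
  refine ⟨nonwrapping_mlq T, ?_, fun a ha => h3 a ?_⟩
  · rw [← (nonwrapping_mlq T).map_length_tab, tab_mlq h1, h2]
  · rw [← tab_mlq h1]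
    exact (Icol_flatten_perm _).symm.subset ha

theorem bijOn_mlq (s : List ℕ) (p : ℕ → Prop) :
    Set.BijOn mlq (tableauxOf s p) (queuesOf s p) :=
  (invOn_tab_mlq s p).bijOn (mapsTo_mlq s p) (mapsTo_tab s p)

theorem bijOn_tab (s : List ℕ) (p : ℕ → Prop) :
    Set.BijOn tab (queuesOf s p) (tableauxOf s p) :=
  (invOn_tab_mlq s p).symm.bijOn (mapsTo_tab s p) (mapsTo_mlq s p)

theorem mlq_insertTab {T : List (List ℕ)} (h : IsTableau T) (k : ℕ) :
    mlq (insertTab k T) = insertMLQ k (mlq T) := by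
  have hM := nonwrapping_mlq T
  refine tab_injective (nonwrapping_mlq _) (insertMLQ_spec hM.chain k).1 ?_
  rw [tab_mlq (h.insertTab k), tab_insertMLQ hM.chain, tab_mlq h]

theorem SSYT_eq (lam : YoungDiagram) :
    SSYT lam = tableauxOf ((List.range (lam.rowLen 0)).map lam.colLen) (0 < ·) :=
  Set.ext fun C => exists_columns_iff lam (0 < ·) C

theorem SSYTBounded_eq (lam : YoungDiagram) (n : ℕ) :
    SSYTBounded lam n =
      tableauxOf ((List.range (lam.rowLen 0)).map lam.colLen) (fun a => 0 < a ∧ a ≤ n) :=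
  Set.ext fun C => exists_columns_iff lam (fun a => 0 < a ∧ a ≤ n) C

theorem MLQ₀_eq (lam : YoungDiagram) :
    MLQ₀ lam = queuesOf ((List.range (lam.rowLen 0)).map lam.colLen) (0 < ·) :=
  Set.ext fun _ => mem_MLQ₀_iff

theorem MLQ₀Bounded_eq (lam : YoungDiagram) (n : ℕ) :
    MLQ₀Bounded lam n =
      queuesOf ((List.range (lam.rowLen 0)).map lam.colLen) (fun a => 0 < a ∧ a ≤ n) :=
  Set.ext fun _ => mem_MLQ₀Bounded_iff

end MultilineQueue

theorem mainTheorem11 (lam : YoungDiagram) :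
    -- the maps are mutually inverse bijections between `SSYT(λ)` and `MLQ_0(λ)`
    (Set.BijOn mlq (SSYT lam) (MLQ₀ lam) ∧
      Set.BijOn tab (MLQ₀ lam) (SSYT lam) ∧
      Set.InvOn tab mlq (SSYT lam) (MLQ₀ lam)) ∧
    -- they preserve the weight
    ((∀ T ∈ SSYT lam, mlqWeight (mlq T) = tabWeight T) ∧
      (∀ M ∈ MLQ₀ lam, tabWeight (tab M) = mlqWeight M)) ∧
    -- they restrict to `SSYT(λ, n)` and `MLQ_0(λ, n)` for every number `n` of columns
    (∀ n : ℕ, Set.BijOn mlq (SSYTBounded lam n) (MLQ₀Bounded lam n) ∧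
      Set.BijOn tab (MLQ₀Bounded lam n) (SSYTBounded lam n)) ∧
    -- they are compatible with insertion
    (∀ k : ℕ, 0 < k →
      (∀ T ∈ SSYT lam, mlq (insertTab k T) = insertMLQ k (mlq T)) ∧
      (∀ M ∈ MLQ₀ lam, tab (insertMLQ k M) = insertTab k (tab M))) := by
  simp only [SSYT_eq, SSYTBounded_eq, MLQ₀_eq, MLQ₀Bounded_eq]
  refine ⟨⟨bijOn_mlq _ _, bijOn_tab _ _, invOn_tab_mlq _ _⟩, ⟨fun T hT => ?_, fun M _ => ?_⟩,
    fun n => ⟨bijOn_mlq _ _, bijOn_tab _ _⟩, fun k _ => ⟨fun T hT => ?_, fun M hM => ?_⟩⟩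
  · rw [← tabWeight_tab, tab_mlq hT.1]
  · exact tabWeight_tab M
  · exact mlq_insertTab hT.1 k
  · exact tab_insertMLQ hM.1.chain k
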